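/- **Setting.** For a group $G$ and a subset $S\subseteq G$ let $G^+$ be the submonoid generated by $S$. For $a,b\in G^+$ write $a\preceq b$ if $b=ac$ with $c\in G^+$, and $b\succeq a$ if $b=ca$ with $c\in G^+$. For $a,b\in G$ write $a\le b$ if $b=cac'$ with $c,c'\in G^+$. An lcm monoid is a cancellative monoid in which any two elements have a left and a right lcm, and in which for each element $a$ the number of factors in expressions of $a$ as a product of elements $\neq 1$ is bounded. $(G,S)$ is a *Garside system* if $G^+$ is an lcm monoid, $G$ is its group of fractions, and there is $\Delta\in G^+$ whose sets of left and of right divisors in $G^+$ both equal $S$, where $S$ is finite and generates $G$. It is *of spindle type* if for all $a,b\in S$ the left gcd $a\wedge b$ and the right gcd of $a$ and $b$ in $G^+$ lie in $\{a,b,1\}$. Let $X$ be the set of atoms of $G^+$ (elements $a\ne1$ such that $a=bc$ with $b,c\in G^+$ implies $b=1$ or $c=1$). The system has a *homogeneous presentation* if $G$ or $G^+$ admits a presentation $\langle X\mid R_1=R_1',\dots,R_m=R_m'\rangle$ with $R_i,R_i'\in X^*$ and $|R_i|=|R_i'|$. Let $X^-=\{x^{-1}: x\in X\}$ be the set of formal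 inverses and $X^{\pm}=X\cup X^-$. For a word $w\in(X^{\pm})^*$ let $\overline w\in G$ be the element it represents and $|w|$ its length. Let $\tau(a)=\Delta^{-1}a\Delta$, applied letterwise to words. **Normal form.** $\Delta^p s_1\cdots s_l$ is a *left normal form* if $s_i\in S$, $s_i=\Delta\wedge(s_i\cdots s_l)$ for all $i$, $s_l\neq 1$ if $l\ge 1$, and $p$ is the greatest integer $r$ with $\Delta^r\le \Delta^p s_1\cdots s_l$. **Reduction.** Fix a word $D\in X^*$ with $\overline D=\Delta$. For a word $w\in (X^{\pm})^*$ consider a decomposition $w\equiv D^r w_1\cdots w_s$ (equality of words) with $r\in\mathbb Z$, in which each $w_i$ is either *positive*: $w_i\in X^*$ and $\overline{w_i}\in S\setminus\{1,\Delta\}$, or *negative*: $w_i\in(X^-)^*$ and $\overline{w_i}^{\,-1}\in S\setminus\{1,\Delta\}$, and for which $s$ is minimal among all such decompositions of $w$ (over all $r$). The operation $\mathrm{red}$ is defined, up to the choices made, as follows. 1. If $r\ge 0$ or all $w_i$ are negative, then $\mathrm{red}(w)\equiv w$. 2. Otherwise choose a positive $w_k$ whose word length is maximal among the positive $w_i$,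 and a word $w_k'$ of minimal length among the words in $(X^-)^*$ with $\Delta\,\overline{w_k'}=\overline{w_k}$, and put $$\mathrm{red}(w)\equiv D^{r+1}\,\tau(w_1)\cdots\tau(w_{k-1})\,w_k'\,w_{k+1}\cdots w_s .$$ Put $\mathrm{Red}(w)\equiv \mathrm{red}^{|r|}(w)$ with $r$ taken from such a minimal decomposition of $w$. **Lemma.** Let $(G,S)$ with $S=\mathrm{Div}(\Delta)$ be a Garside system of spindle type with homogeneous presentation, and let $X$ be its set of atoms. Let $w_{LNF}\equiv D^p w_1\cdots w_l$ be a word in left normal form, i.e. $D,w_1,\dots,w_l\in X^*$, $\overline D=\Delta$, and $\Delta^p\,\overline{w_1}\cdots\overline{w_l}$ is a left normal form. Then $\mathrm{Red}(w_{LNF})$ has at least one value, and for every possible value $v$ of $\mathrm{Red}(w_{LNF})$ (whatever choices are made), $v\in(X^{\pm})^*$, $\overline v=\overline{w_{LNF}}$, and for all words $w\in(X^{\pm})^*$ with $\overline w=\overline{w_{LNF}}$, $$|v|\le |w| .$$ That is, $\mathrm{Red}(w_{LNF})$ is a geodesic word with respect to $X$. -/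

import Mathlib

namespace SpindleGarside

section Divisibility

variable {G : Type*} [Group G]

/-- `a` is a left divisor of `b` with respect to the submonoid `P`: `b = a * c` for some `c ∈ P`.
For `a b ∈ P` this is left divisibility in the monoid `P`. -/
def LeftDvd (P : Submonoid G) (a b : G) : Prop := ∃ c ∈ P, b = a * c

/-- `a` is a right divisor of `b` with respect to `P`: `b = c * a` for some `c ∈ P`. -/
def RightDvd (P : Submonoid G) (a b : G) : Prop := ∃ c ∈ P, b = c * a

/-- The two-sided order: `a ≤ b` if `b = c * a * c'` with `c, c' ∈ P`. -/
def TwoSidedLE (P : Submonoid G) (a b : G) : Prop := ∃ c ∈ P, ∃ c' ∈ P, b = c * a * c'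

/-- `m` is the right lcm `a ∨ b` of `a` and `b` in the monoid `P`. -/
def IsRightLcm (P : Submonoid G) (a b m : G) : Prop :=
  m ∈ P ∧ LeftDvd P a m ∧ LeftDvd P b m ∧
    ∀ c ∈ P, LeftDvd P a c → LeftDvd P b c → LeftDvd P m c

/-- `m` is the left lcm of `a` and `b` in the monoid `P`. -/
def IsLeftLcm (P : Submonoid G) (a b m : G) : Prop :=
  m ∈ P ∧ RightDvd P a m ∧ RightDvd P b m ∧
    ∀ c ∈ P, RightDvd P a c → RightDvd P b c → RightDvd P m c

/-- `d` is the left gcd `a ∧ b` (greatest common left divisor) of `a` and `b` in `P`. -/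
def IsLeftGcd (P : Submonoid G) (a b d : G) : Prop :=
  d ∈ P ∧ LeftDvd P d a ∧ LeftDvd P d b ∧
    ∀ c ∈ P, LeftDvd P c a → LeftDvd P c b → LeftDvd P c d

/-- `d` is the right gcd (greatest common right divisor) of `a` and `b` in `P`. -/
def IsRightGcd (P : Submonoid G) (a b d : G) : Prop :=
  d ∈ P ∧ RightDvd P d a ∧ RightDvd P d b ∧
    ∀ c ∈ P, RightDvd P c a → RightDvd P c b → RightDvd P c d

/-- `P` is atomic (Noetherian): for every `a ∈ P` there is a bound on the number of factors in
the expressions of `a` as a product of elements of `P` distinct from `1`. -/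
def IsNoetherianMonoid (P : Submonoid G) : Prop :=
  ∀ a ∈ P, ∃ n : ℕ, ∀ l : List G, (∀ x ∈ l, x ∈ P ∧ x ≠ 1) → l.prod = a → l.length ≤ n

/-- `P` is an lcm monoid. Cancellativity is automatic, because `P` is a submonoid of a group. -/
structure IsLcmMonoid (P : Submonoid G) : Prop where
  noetherian : IsNoetherianMonoid P
  exists_rightLcm : ∀ a ∈ P, ∀ b ∈ P, ∃ m, IsRightLcm P a b m
  exists_leftLcm : ∀ a ∈ P, ∀ b ∈ P, ∃ m, IsLeftLcm P a b m

end Divisibility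

section Garside

variable {G : Type*} [Group G]

/-- The monoid `G⁺` generated by `S`. -/
abbrev posMonoid (S : Set G) : Submonoid G := Submonoid.closure S

/-- `(G, S)` is a Garside system with Garside element `Δ`, so that `S = Div(Δ)`. -/
structure IsGarsideSystem (S : Set G) (Δ : G) : Prop where
  lcmMonoid : IsLcmMonoid (posMonoid S)
  fractions : ∀ g : G, ∃ a ∈ posMonoid S, ∃ b ∈ posMonoid S, g = a * b⁻¹
  delta_mem : Δ ∈ posMonoid S
  balanced : ∀ a ∈ posMonoid S, LeftDvd (posMonoid S) a Δ ↔ RightDvd (posMonoid S) a Δ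
  eq_div : S = {a | a ∈ posMonoid S ∧ LeftDvd (posMonoid S) a Δ}
  finite : S.Finite
  generates : Subgroup.closure S = ⊤

/-- Spindle type: for all simple `a`, `b`, the left gcd and the right gcd of `a` and `b`
lie in `{a, b, 1}`. -/
def IsSpindleType (S : Set G) : Prop :=
  ∀ a ∈ S, ∀ b ∈ S,
    (∃ d ∈ ({a, b, 1} : Set G), IsLeftGcd (posMonoid S) a b d) ∧
    (∃ d ∈ ({a, b, 1} : Set G), IsRightGcd (posMonoid S) a b d)

/-- The set `X` of atoms. -/
def atoms (S : Set G) : Set G :=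
  {a | a ∈ posMonoid S ∧ a ≠ 1 ∧
    ∀ b ∈ posMonoid S, ∀ c ∈ posMonoid S, a = b * c → b = 1 ∨ c = 1}

/-- The group `G` admits a finite presentation `⟨X ∣ uᵢ = vᵢ⟩` on the set `X` of atoms with
positive words `uᵢ`, `vᵢ` of equal length. -/
def HasHomogeneousGroupPresentation (S : Set G) : Prop :=
  ∃ R : Set (FreeMonoid (atoms S) × FreeMonoid (atoms S)),
    R.Finite ∧ (∀ r ∈ R, r.1.length = r.2.length) ∧
    ∃ e : PresentedGroup {g : FreeGroup (atoms S) | ∃ r ∈ R,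
        g = FreeMonoid.lift FreeGroup.of r.1 * (FreeMonoid.lift FreeGroup.of r.2)⁻¹} ≃* G,
      ∀ x : atoms S, e (PresentedGroup.of x) = (x : G)

/-- The monoid `G⁺` admits such a presentation (as a monoid). -/
def HasHomogeneousMonoidPresentation (S : Set G) : Prop :=
  ∃ R : Set (FreeMonoid (atoms S) × FreeMonoid (atoms S)),
    R.Finite ∧ (∀ r ∈ R, r.1.length = r.2.length) ∧
    ∃ e : PresentedMonoid (fun u v : FreeMonoid (atoms S) => (u, v) ∈ R) ≃* posMonoid S,
      ∀ x : atoms S, (e (PresentedMonoid.of _ x) : G) = (x : G)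

/-- `G` or `G⁺` admits a homogeneous presentation on the set of atoms. -/
def HasHomogeneousPresentation (S : Set G) : Prop :=
  HasHomogeneousGroupPresentation S ∨ HasHomogeneousMonoidPresentation S

/-- `Δ ^ p * s₁ * ⋯ * sₗ` is a left `Δ`-normal form: the `sᵢ` are simple,
`sᵢ = Δ ∧ (sᵢ ⋯ sₗ)`, `sₗ ≠ 1`, and `p` is the infimum of the element, i.e. the
greatest integer `r` with `Δ ^ r ≤ Δ ^ p * s₁ * ⋯ * sₗ`. -/
structure IsLeftNormalForm (S : Set G) (Δ : G) (p : ℤ) (s : List G) : Prop where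
  simple : ∀ x ∈ s, x ∈ S
  greedy : ∀ (x : G) (t : List G), (x :: t) <:+ s → IsLeftGcd (posMonoid S) Δ (x * t.prod) x
  getLast_ne_one : ∀ h : s ≠ [], s.getLast h ≠ 1
  isGreatest_inf : IsGreatest {r : ℤ | TwoSidedLE (posMonoid S) (Δ ^ r) (Δ ^ p * s.prod)} p

end Garside

section Words

variable {G : Type*} [Group G]

/-- Words in letters `x` (coded as `(x, true)`) and `x⁻¹` (coded as `(x, false)`), `x ∈ G`. -/
abbrev Word (G : Type*) := List (G × Bool)

/-- The group element represented by a word. -/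
def eval (w : Word G) : G := (w.map fun y => if y.2 then y.1 else y.1⁻¹).prod

/-- `w ∈ (X^±)^*`. -/
def IsWord (X : Set G) (w : Word G) : Prop := ∀ y ∈ w, y.1 ∈ X

/-- `w ∈ X^*`. -/
def IsPosWord (X : Set G) (w : Word G) : Prop := ∀ y ∈ w, y.1 ∈ X ∧ y.2 = true

/-- `w ∈ (X^-)^*`. -/
def IsNegWord (X : Set G) (w : Word G) : Prop := ∀ y ∈ w, y.1 ∈ X ∧ y.2 = false

/-- The word `D ^ r`: the concatenation of `|r|` copies of `D`, respectively of the formal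
inverse of `D` if `r < 0`. -/
def wordPow (D : Word G) (r : ℤ) : Word G :=
  (List.replicate r.natAbs (if 0 ≤ r then D else FreeGroup.invRev D)).flatten

/-- The letterwise action of `τ : a ↦ Δ⁻¹ * a * Δ` on words. -/
def tauWord (Δ : G) (w : Word G) : Word G := w.map fun y => (Δ⁻¹ * y.1 * Δ, y.2)

/-- A positive word that represents an element of `S \ {1, Δ}`. -/
def IsPosBlock (S : Set G) (Δ : G) (u : Word G) : Prop :=
  IsPosWord (atoms S) u ∧ eval u ∈ S \ {1, Δ}

/-- A negative word that represents the inverse of an element of `S \ {1, Δ}`. -/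
def IsNegBlock (S : Set G) (Δ : G) (u : Word G) : Prop :=
  IsNegWord (atoms S) u ∧ (eval u)⁻¹ ∈ S \ {1, Δ}

/-- `w ≡ D ^ r w₁ ⋯ wₛ` as words, where `D` is the chosen word for `Δ` and every `wᵢ` is a word
for an element of `(S \ {1, Δ})^±`. -/
def IsDecomposition (S : Set G) (Δ : G) (D w : Word G) (r : ℤ) (L : List (Word G)) : Prop :=
  w = wordPow D r ++ L.flatten ∧ ∀ u ∈ L, IsPosBlock S Δ u ∨ IsNegBlock S Δ u

/-- A decomposition of `w` for which the number `s` of factors `wᵢ` is minimal. -/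
def IsMinDecomposition (S : Set G) (Δ : G) (D w : Word G) (r : ℤ) (L : List (Word G)) : Prop :=
  IsDecomposition S Δ D w r L ∧
    ∀ (r' : ℤ) (L' : List (Word G)), IsDecomposition S Δ D w r' L' → L.length ≤ L'.length

/-- `v` is a word of minimal length among the words in `(X^-)^*` with `Δ * v = u` in `G`. -/
def IsMinNegComplement (S : Set G) (Δ : G) (u v : Word G) : Prop :=
  IsNegWord (atoms S) v ∧ Δ * eval v = eval u ∧
    ∀ v' : Word G, IsNegWord (atoms S) v' → Δ * eval v' = eval u → v.length ≤ v'.length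

/-- `v` is a possible value of `red(w)`: with `w ≡ D ^ r w₁ ⋯ wₛ`, `s` minimal,
either `r ≥ 0` or all `wᵢ` are negative, and `v ≡ w`; or `r < 0`, `w_k` is a positive factor of
maximal word length, and `v ≡ D ^ (r + 1) τ(w₁) ⋯ τ(w_{k-1}) w'_k w_{k+1} ⋯ wₛ`. -/
def RedStep (S : Set G) (Δ : G) (D w v : Word G) : Prop :=
  ∃ (r : ℤ) (L : List (Word G)), IsMinDecomposition S Δ D w r L ∧
    (((0 ≤ r ∨ ∀ u ∈ L, IsNegBlock S Δ u) ∧ v = w) ∨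
      (r < 0 ∧ ∃ (L₁ : List (Word G)) (u : Word G) (L₂ : List (Word G)) (u' : Word G),
        L = L₁ ++ u :: L₂ ∧ IsPosBlock S Δ u ∧
        (∀ x ∈ L, IsPosBlock S Δ x → x.length ≤ u.length) ∧
        IsMinNegComplement S Δ u u' ∧
        v = wordPow D (r + 1) ++ (L₁.map (tauWord Δ)).flatten ++ u' ++ L₂.flatten))

/-- The `n`-fold composition of a relation with itself. -/
def iterRel {α : Type*} (R : α → α → Prop) : ℕ → α → α → Prop
  | 0 => fun a b => a = b
  | n + 1 => fun a b => ∃ c, R a c ∧ iterRel R n c b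

/-- `v` is a possible value of `Red(w) ≡ red^|r|(w)`, where `w ≡ D ^ r w₁ ⋯ wₛ` with `s`
minimal. -/
def IsRed (S : Set G) (Δ : G) (D w v : Word G) : Prop :=
  ∃ (r : ℤ) (L : List (Word G)), IsMinDecomposition S Δ D w r L ∧
    iterRel (RedStep S Δ D) r.natAbs w v

end Words

end SpindleGarside

namespace SpindleGarside

variable {G : Type*} [Group G] {S : Set G} {Δ : G} {ℓ : G → ℤ}

/-! Homogeneity gives an additive length `ℓ` on the positive monoid with value 1 on atoms, so every
positive word for `a` has exactly `ℓ a` letters. Put δ = `ℓ Δ`. A proper simple factor of length a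
can be spelled by a letters, or as Δ times a negative word of δ - a letters, the Δ being carried to
the left into the power of Δ. Making k factors of the normal form with exponent p negative thus
gives a word of length |p + k|δ plus the lengths of the blocks (`Cost`, `Reach`).

Some word of this shape is geodesic. By the spindle condition the left divisors of a simple element
other than Δ form a chain (`leftDvd_total`), so right multiplication by an atom touches only the
last factor, up to conjugation by Δ, and moves the least achievable length by at most one
(`IsNF.mul_atom`). Reading any word letter by letter bounds its length from below
(`exists_reach_of_word`).

Which factors to make negative is an exchange problem: the longest ones, until the exponent reaches
0 or no positive factor remains. A length threshold acts as a Lagrange multiplier that certifies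
optimality (`Conv.length_le_cost`, `IsReducing.geodesic`), and each reduction step keeps such a
threshold (`IsReducing.redStep`).

Finally, the choice of decomposition is harmless. A product of proper simple elements is in normal
form or has a strictly shorter one (`exists_isNF`), so a minimal decomposition spells the normal
form, and lengths and signs then determine it as a word (`Conv.unique`). -/

/-! ### The length function of a homogeneous presentation -/

/-- An additive length function on the positive monoid that takes the value `1` on atoms. -/
structure IsLengthFun (S : Set G) (ℓ : G → ℤ) : Prop where
  map_mul : ∀ a ∈ posMonoid S, ∀ b ∈ posMonoid S, ℓ (a * b) = ℓ a + ℓ b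
  atom : ∀ x ∈ atoms S, ℓ x = 1

lemma exists_isLengthFun_of_group (h : HasHomogeneousGroupPresentation S) :
    ∃ ℓ : G → ℤ, IsLengthFun S ℓ := by
  obtain ⟨R, -, hlen, e, he⟩ := h
  let f : atoms S → Multiplicative ℤ := fun _ => Multiplicative.ofAdd 1
  have key : ∀ u : FreeMonoid (atoms S),
      FreeGroup.lift f (FreeMonoid.lift FreeGroup.of u) =
        Multiplicative.ofAdd (u.length : ℤ) := by
    intro u
    induction u using FreeMonoid.inductionOn' with
    | one => simp
    | of_mul x u ih => simp [ih, f, ofAdd_add]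
  have hf : ∀ g ∈ {g : FreeGroup (atoms S) | ∃ r ∈ R,
      g = FreeMonoid.lift FreeGroup.of r.1 * (FreeMonoid.lift FreeGroup.of r.2)⁻¹},
      FreeGroup.lift f g = 1 := by
    rintro g ⟨r, hr, rfl⟩
    rw [map_mul, map_inv, key, key, hlen r hr, mul_inv_cancel]
  refine ⟨fun g => Multiplicative.toAdd (PresentedGroup.toGroup hf (e.symm g)), ?_, ?_⟩
  · intro a _ b _
    simp
  · intro x hx
    have : e.symm x = PresentedGroup.of (⟨x, hx⟩ : atoms S) := by
      rw [MulEquiv.symm_apply_eq, he]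
    simp only [this, PresentedGroup.toGroup.of]
    rfl

lemma exists_isLengthFun_of_monoid (h : HasHomogeneousMonoidPresentation S) :
    ∃ ℓ : G → ℤ, IsLengthFun S ℓ := by
  classical
  obtain ⟨R, -, hlen, e, he⟩ := h
  let f : atoms S → Multiplicative ℤ := fun _ => Multiplicative.ofAdd 1
  have key : ∀ u : FreeMonoid (atoms S),
      FreeMonoid.lift f u = Multiplicative.ofAdd (u.length : ℤ) := by
    intro u
    induction u using FreeMonoid.inductionOn' with
    | one => simp
    | of_mul x u ih => simp [ih, f, ofAdd_add]
  have hf : ∀ a b : FreeMonoid (atoms S), (a, b) ∈ R →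
      FreeMonoid.lift f a = FreeMonoid.lift f b := by
    intro a b hab
    rw [key, key, hlen _ hab]
  -- The value 0 outside the positive monoid is arbitrary: additivity is only required inside it.
  refine ⟨fun g => if hg : g ∈ posMonoid S then
    Multiplicative.toAdd (PresentedMonoid.lift f hf (e.symm ⟨g, hg⟩)) else 0, ?_, ?_⟩
  · intro a ha b hb
    simp only [ha, hb, mul_mem ha hb, dif_pos]
    rw [← toAdd_mul, ← map_mul, ← map_mul]
    rfl
  · intro x hx
    have : e.symm ⟨x, hx.1⟩ = PresentedMonoid.of _ (⟨x, hx⟩ : atoms S) := by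
      rw [MulEquiv.symm_apply_eq]
      exact Subtype.ext (he ⟨x, hx⟩).symm
    simp only [hx.1, dif_pos, this, PresentedMonoid.lift_of]
    rfl

lemma exists_isLengthFun (h : HasHomogeneousPresentation S) : ∃ ℓ : G → ℤ, IsLengthFun S ℓ :=
  h.elim exists_isLengthFun_of_group exists_isLengthFun_of_monoid

/-! ### Positive words and their lengths -/

@[simp] lemma eval_nil : eval ([] : Word G) = 1 := rfl

@[simp] lemma eval_append (u v : Word G) : eval (u ++ v) = eval u * eval v := by
  simp [eval]

lemma eval_cons (y : G × Bool) (w : Word G) :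
    eval (y :: w) = (if y.2 then y.1 else y.1⁻¹) * eval w := by
  simp [eval]

/-- If a = b * c with both factors nontrivial, then adjoining c to a factorization of b, or b to one
of c, gives a longer factorization of a. So the bound drops by one for both factors and the
induction ends at atoms. -/
lemma exists_posWord_of_bound (n : ℕ) : ∀ a ∈ posMonoid S,
    (∀ l : List G, (∀ x ∈ l, x ∈ posMonoid S ∧ x ≠ 1) → l.prod = a → l.length ≤ n) →
    ∃ w, IsPosWord (atoms S) w ∧ eval w = a := by
  induction n with
  | zero =>
    intro a ha h
    by_cases h1 : a = 1
    · exact ⟨[], by simp [IsPosWord], by simp [h1]⟩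
    · have := h [a] (by simp [ha, h1]) (by simp)
      simp at this
  | succ n ih =>
    intro a ha h
    by_cases h1 : a = 1
    · exact ⟨[], by simp [IsPosWord], by simp [h1]⟩
    by_cases hat : a ∈ atoms S
    · exact ⟨[(a, true)], by simp [IsPosWord, hat], by simp [eval]⟩
    have : ∃ b ∈ posMonoid S, ∃ c ∈ posMonoid S, a = b * c ∧ b ≠ 1 ∧ c ≠ 1 := by
      by_contra hcon
      push Not at hcon
      refine hat ⟨ha, h1, fun b hb c hc habc => ?_⟩
      by_cases hb1 : b = 1
      · exact Or.inl hb1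
      · exact Or.inr (hcon b hb c hc habc hb1)
    obtain ⟨b, hb, c, hc, rfl, hb1, hc1⟩ := this
    obtain ⟨u, hu, rfl⟩ := ih b hb fun l hl hlb => by
      have := h (l ++ [c]) (by
        intro x hx
        rcases List.mem_append.1 hx with hx | hx
        · exact hl x hx
        · rw [List.mem_singleton.1 hx]; exact ⟨hc, hc1⟩) (by simp [hlb])
      simpa using this
    obtain ⟨v, hv, rfl⟩ := ih c hc fun l hl hlc => by
      have := h (eval u :: l) (by
        intro x hx
        rcases List.mem_cons.1 hx with rfl | hx
        · exact ⟨hb, hb1⟩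
        · exact hl x hx) (by simp [hlc])
      simpa using this
    refine ⟨u ++ v, fun y hy => ?_, by simp⟩
    exact (List.mem_append.1 hy).elim (hu y) (hv y)

lemma IsGarsideSystem.exists_posWord (hG : IsGarsideSystem S Δ) {a : G} (ha : a ∈ posMonoid S) :
    ∃ w, IsPosWord (atoms S) w ∧ eval w = a := by
  obtain ⟨n, hn⟩ := hG.lcmMonoid.noetherian a ha
  exact exists_posWord_of_bound n a ha hn

lemma IsPosWord.eval_mem {w : Word G} (hw : IsPosWord (atoms S) w) : eval w ∈ posMonoid S := by
  refine Submonoid.list_prod_mem _ fun x hx => ?_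
  obtain ⟨y, hy, rfl⟩ := List.mem_map.1 hx
  simpa [(hw y hy).2] using (hw y hy).1.1

lemma IsLengthFun.map_one (hℓ : IsLengthFun S ℓ) : ℓ 1 = 0 := by
  have := hℓ.map_mul 1 (one_mem _) 1 (one_mem _)
  simpa using this

lemma IsLengthFun.eval (hℓ : IsLengthFun S ℓ) {w : Word G} (hw : IsPosWord (atoms S) w) :
    ℓ (eval w) = w.length := by
  induction w with
  | nil => simp [hℓ.map_one]
  | cons y w ih =>
    have hy := hw y (by simp)
    have hw' : IsPosWord (atoms S) w := fun z hz => hw z (by simp [hz])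
    rw [eval_cons, if_pos hy.2, hℓ.map_mul _ hy.1.1 _ hw'.eval_mem, ih hw', hℓ.atom _ hy.1]
    push_cast [List.length_cons]
    ring

lemma length_nonneg (hG : IsGarsideSystem S Δ) (hℓ : IsLengthFun S ℓ) {a : G}
    (ha : a ∈ posMonoid S) : 0 ≤ ℓ a := by
  obtain ⟨w, hw, rfl⟩ := hG.exists_posWord ha
  rw [hℓ.eval hw]
  positivity

lemma length_pos (hG : IsGarsideSystem S Δ) (hℓ : IsLengthFun S ℓ) {a : G}
    (ha : a ∈ posMonoid S) (h1 : a ≠ 1) : 0 < ℓ a := by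
  obtain ⟨w, hw, rfl⟩ := hG.exists_posWord ha
  rw [hℓ.eval hw]
  cases w with
  | nil => exact absurd rfl h1
  | cons y w => simp

lemma eq_one_of_mul_eq_one (hG : IsGarsideSystem S Δ) (hℓ : IsLengthFun S ℓ) {a b : G}
    (ha : a ∈ posMonoid S) (hb : b ∈ posMonoid S) (h : a * b = 1) : a = 1 := by
  by_contra h1
  have h2 := length_pos hG hℓ ha h1
  have h3 := length_nonneg hG hℓ hb
  have h4 := hℓ.map_mul a ha b hb
  rw [h, hℓ.map_one] at h4
  omega

/-! ### Divisibility and simple elements -/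

lemma LeftDvd.antisymm (hG : IsGarsideSystem S Δ) (hℓ : IsLengthFun S ℓ) {a b : G}
    (hab : LeftDvd (posMonoid S) a b) (hba : LeftDvd (posMonoid S) b a) : a = b := by
  obtain ⟨c, hc, rfl⟩ := hab
  obtain ⟨d, hd, h⟩ := hba
  have : c * d = 1 := by
    rw [mul_assoc] at h
    exact (mul_eq_left.1 h.symm)
  rw [eq_one_of_mul_eq_one hG hℓ hc hd this, mul_one]

lemma LeftDvd.trans {P : Submonoid G} {a b c : G} (h : LeftDvd P a b) (h' : LeftDvd P b c) :
    LeftDvd P a c := by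
  obtain ⟨x, hx, rfl⟩ := h
  obtain ⟨y, hy, rfl⟩ := h'
  exact ⟨x * y, mul_mem hx hy, by group⟩

namespace IsGarsideSystem

lemma mem_iff (hG : IsGarsideSystem S Δ) {a : G} :
    a ∈ S ↔ a ∈ posMonoid S ∧ LeftDvd (posMonoid S) a Δ := by
  conv_lhs => rw [hG.eq_div]
  rfl

lemma mem_iff_right (hG : IsGarsideSystem S Δ) {a : G} :
    a ∈ S ↔ a ∈ posMonoid S ∧ RightDvd (posMonoid S) a Δ := by
  rw [hG.mem_iff]
  exact and_congr_right fun ha => hG.balanced a ha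

lemma delta_mem_simple (hG : IsGarsideSystem S Δ) : Δ ∈ S :=
  hG.mem_iff.2 ⟨hG.delta_mem, 1, one_mem _, by simp⟩

lemma mem_of_leftDvd (hG : IsGarsideSystem S Δ) {a b : G} (ha : a ∈ posMonoid S) (hb : b ∈ S)
    (h : LeftDvd (posMonoid S) a b) : a ∈ S :=
  hG.mem_iff.2 ⟨ha, h.trans (hG.mem_iff.1 hb).2⟩

lemma mem_of_rightDvd (hG : IsGarsideSystem S Δ) {a b : G} (ha : a ∈ posMonoid S) (hb : b ∈ S)
    (h : RightDvd (posMonoid S) a b) : a ∈ S := by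
  obtain ⟨c, hc, rfl⟩ := h
  obtain ⟨d, hd, h⟩ := (hG.mem_iff_right.1 hb).2
  exact hG.mem_iff_right.2 ⟨ha, d * c, mul_mem hd hc, by rw [h]; group⟩

lemma compl_mem (hG : IsGarsideSystem S Δ) {a : G} (ha : a ∈ S) : a⁻¹ * Δ ∈ S := by
  obtain ⟨haP, c, hc, h⟩ := hG.mem_iff.1 ha
  have : a⁻¹ * Δ = c := by rw [h]; group
  rw [this]
  exact hG.mem_iff_right.2 ⟨hc, a, haP, h⟩

lemma compl_mem_left (hG : IsGarsideSystem S Δ) {a : G} (ha : a ∈ S) : Δ * a⁻¹ ∈ S := by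
  obtain ⟨haP, c, hc, h⟩ := hG.mem_iff_right.1 ha
  have : Δ * a⁻¹ = c := by rw [h]; group
  rw [this]
  exact hG.mem_iff.2 ⟨hc, a, haP, h⟩

lemma mem_pos (hG : IsGarsideSystem S Δ) {a : G} (ha : a ∈ S) : a ∈ posMonoid S :=
  (hG.mem_iff.1 ha).1

end IsGarsideSystem

/-! ### Conjugation by powers of Δ; τ is `twist Δ (-1)` -/

/-- Conjugation by `Δ ^ k`. -/
def twist (Δ : G) (k : ℤ) : G ≃* G := MulAut.conj (Δ ^ k)

lemma twist_apply (k : ℤ) (x : G) : twist Δ k x = Δ ^ k * x * (Δ ^ k)⁻¹ := rfl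

lemma twist_twist (j k : ℤ) (x : G) : twist Δ j (twist Δ k x) = twist Δ (j + k) x := by
  simp only [twist_apply, zpow_add]
  group

@[simp] lemma twist_zero (x : G) : twist Δ 0 x = x := by simp [twist_apply]

@[simp] lemma twist_delta (k : ℤ) : twist Δ k Δ = Δ := by
  simp only [twist_apply]; group

lemma twist_neg_one (x : G) : twist Δ (-1) x = Δ⁻¹ * x * Δ := by simp [twist_apply]

lemma twist_mem_of_subset {k : ℤ} (h : ∀ a ∈ S, twist Δ k a ∈ S) {a : G}
    (ha : a ∈ posMonoid S) : twist Δ k a ∈ posMonoid S := by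
  induction ha using Submonoid.closure_induction with
  | mem x hx => exact Submonoid.subset_closure (h x hx)
  | one => simp
  | mul x y _ _ hx hy => rw [map_mul]; exact mul_mem hx hy

/-- Conjugation by Δ or its inverse is the square of a complement map, and complements of simple
elements are simple. -/
lemma twist_mem_simple (hG : IsGarsideSystem S Δ) (k : ℤ) : ∀ a ∈ S, twist Δ k a ∈ S := by
  induction k using Int.induction_on with
  | zero => simp
  | succ k ih =>
    intro a ha
    have h := hG.compl_mem_left (hG.compl_mem_left (ih a ha))
    rw [add_comm, ← twist_twist, twist_apply 1]
    simpa [mul_assoc] using h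
  | pred k ih =>
    intro a ha
    have h := hG.compl_mem (hG.compl_mem (ih a ha))
    rw [sub_eq_add_neg, add_comm, ← twist_twist, twist_neg_one]
    simpa [mul_assoc] using h

lemma twist_mem_simple_iff (hG : IsGarsideSystem S Δ) (k : ℤ) {a : G} :
    twist Δ k a ∈ S ↔ a ∈ S := by
  refine ⟨fun h => ?_, twist_mem_simple hG k a⟩
  have := twist_mem_simple hG (-k) _ h
  rwa [twist_twist, neg_add_cancel, twist_zero] at this

lemma twist_mem_pos_iff (hG : IsGarsideSystem S Δ) (k : ℤ) {a : G} :
    twist Δ k a ∈ posMonoid S ↔ a ∈ posMonoid S := by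
  refine ⟨fun h => ?_, twist_mem_of_subset (twist_mem_simple hG k)⟩
  have := twist_mem_of_subset (twist_mem_simple hG (-k)) h
  rwa [twist_twist, neg_add_cancel, twist_zero] at this

lemma twist_mem_proper_iff (hG : IsGarsideSystem S Δ) (k : ℤ) {a : G} :
    twist Δ k a ∈ S \ {1, Δ} ↔ a ∈ S \ {1, Δ} := by
  have h1 : twist Δ k a = Δ ↔ a = Δ := by
    rw [← (twist Δ k).injective.eq_iff (a := a) (b := Δ), twist_delta]
  simp [twist_mem_simple_iff hG, h1]

lemma twist_mem_atoms (hG : IsGarsideSystem S Δ) (k : ℤ) {a : G} (ha : a ∈ atoms S) :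
    twist Δ k a ∈ atoms S := by
  obtain ⟨h1, h2, h3⟩ := ha
  refine ⟨(twist_mem_pos_iff hG k).2 h1, by simpa using h2, fun b hb c hc h => ?_⟩
  have := h3 (twist Δ (-k) b) ((twist_mem_pos_iff hG _).2 hb)
    (twist Δ (-k) c) ((twist_mem_pos_iff hG _).2 hc) (by
      rw [← map_mul, ← h, twist_twist, neg_add_cancel, twist_zero])
  simpa using this

lemma leftDvd_twist_iff (hG : IsGarsideSystem S Δ) (k : ℤ) {a b : G} :
    LeftDvd (posMonoid S) (twist Δ k a) (twist Δ k b) ↔ LeftDvd (posMonoid S) a b := by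
  constructor
  · rintro ⟨c, hc, h⟩
    refine ⟨twist Δ (-k) c, (twist_mem_pos_iff hG _).2 hc, (twist Δ k).injective ?_⟩
    rw [h, map_mul, twist_twist, add_neg_cancel, twist_zero]
  · rintro ⟨c, hc, rfl⟩
    exact ⟨twist Δ k c, (twist_mem_pos_iff hG _).2 hc, map_mul _ _ _⟩

lemma length_twist_one (hG : IsGarsideSystem S Δ) (hℓ : IsLengthFun S ℓ) {a : G}
    (ha : a ∈ posMonoid S) : ℓ (twist Δ 1 a) = ℓ a := by
  have h := hℓ.map_mul _ ((twist_mem_pos_iff hG 1).2 ha) Δ hG.delta_mem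
  have h' := hℓ.map_mul Δ hG.delta_mem a ha
  have : twist Δ 1 a * Δ = Δ * a := by simp [twist_apply]
  rw [this] at h
  omega

lemma length_twist (hG : IsGarsideSystem S Δ) (hℓ : IsLengthFun S ℓ) (k : ℤ) : ∀ {a : G},
    a ∈ posMonoid S → ℓ (twist Δ k a) = ℓ a := by
  induction k using Int.induction_on with
  | zero => simp
  | succ k ih =>
    intro a ha
    rw [add_comm, ← twist_twist, length_twist_one hG hℓ ((twist_mem_pos_iff hG _).2 ha), ih ha]
  | pred k ih =>
    intro a ha
    rw [← length_twist_one hG hℓ ((twist_mem_pos_iff hG _).2 ha), twist_twist,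
      show (1 : ℤ) + (-k - 1) = -k by ring, ih ha]

lemma length_lt_delta (hG : IsGarsideSystem S Δ) (hℓ : IsLengthFun S ℓ) {a : G}
    (ha : a ∈ S \ {1, Δ}) : 0 < ℓ a ∧ ℓ a < ℓ Δ := by
  obtain ⟨haS, h⟩ := ha
  simp only [Set.mem_insert_iff, Set.mem_singleton_iff, not_or] at h
  refine ⟨length_pos hG hℓ (hG.mem_pos haS) h.1, ?_⟩
  obtain ⟨haP, c, hc, hΔ⟩ := hG.mem_iff.1 haS
  have hc1 : c ≠ 1 := by
    rintro rfl
    exact h.2 (by simpa using hΔ.symm)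
  have := hℓ.map_mul a haP c hc
  rw [← hΔ] at this
  have := length_pos hG hℓ hc hc1
  omega

/-! ### Greedy normal forms and their uniqueness -/

/-- The pair `(a, b)` is greedy: no nontrivial left divisor of `b` can be moved into `a`. -/
def Greedy (S : Set G) (a b : G) : Prop :=
  ∀ c ∈ posMonoid S, LeftDvd (posMonoid S) c b → a * c ∈ S → c = 1

/-- A list of proper simple elements in which consecutive pairs are greedy. -/
def IsNF (S : Set G) (Δ : G) (t : List G) : Prop :=
  (∀ x ∈ t, x ∈ S \ {1, Δ}) ∧ t.IsChain (Greedy S)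

lemma greedy_twist (hG : IsGarsideSystem S Δ) (k : ℤ) {a b : G} (h : Greedy S a b) :
    Greedy S (twist Δ k a) (twist Δ k b) := by
  intro c hc hcb hac
  have hc' : twist Δ k (twist Δ (-k) c) = c := by rw [twist_twist, add_neg_cancel, twist_zero]
  rw [← hc'] at hcb hac
  rw [← map_mul] at hac
  have := h _ ((twist_mem_pos_iff hG (-k)).2 hc) ((leftDvd_twist_iff hG k).1 hcb)
    ((twist_mem_simple_iff hG k).1 hac)
  simpa using this

lemma IsNF.map_twist (hG : IsGarsideSystem S Δ) (k : ℤ) {t : List G} (h : IsNF S Δ t) :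
    IsNF S Δ (t.map (twist Δ k)) := by
  refine ⟨fun x hx => ?_, ?_⟩
  · obtain ⟨y, hy, rfl⟩ := List.mem_map.1 hx
    exact (twist_mem_proper_iff hG k).2 (h.1 y hy)
  · rw [List.isChain_map]
    exact h.2.imp fun a b hab => greedy_twist hG k hab

lemma prod_map_twist (k : ℤ) (t : List G) :
    (t.map (twist Δ k)).prod = Δ ^ k * t.prod * (Δ ^ k)⁻¹ := by
  rw [← twist_apply, map_list_prod]

lemma isNF_append_singleton {t : List G} {a : G} : IsNF S Δ (t ++ [a]) ↔
    IsNF S Δ t ∧ a ∈ S \ {1, Δ} ∧ ∀ x ∈ t.getLast?, Greedy S x a := by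
  simp only [IsNF, List.mem_append, List.mem_singleton, or_imp, forall_and, forall_eq,
    List.isChain_append, List.isChain_singleton, List.head?_cons, Option.mem_some_iff]
  constructor
  · rintro ⟨⟨h1, h2⟩, h3, -, h4⟩
    exact ⟨⟨h1, h3⟩, h2, fun x hx => h4 x hx a rfl⟩
  · rintro ⟨⟨h1, h3⟩, h2, h4⟩
    exact ⟨⟨h1, h2⟩, h3, trivial, fun x hx y hy => hy ▸ h4 x hx⟩

lemma prod_mem_of_proper (hG : IsGarsideSystem S Δ) {t : List G}
    (h : ∀ x ∈ t, x ∈ S \ {1, Δ}) : t.prod ∈ posMonoid S :=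
  Submonoid.list_prod_mem _ fun x hx => hG.mem_pos (h x hx).1

/-- The right lcm of `c` and `a` divides both Δ and `a * y`, so it has the form `a * d` with `a * d`
simple and `d` dividing `y`. Then `d` divides `b`, and greediness forces `d = 1`. This is the step
from local to global greediness. -/
lemma leftDvd_greedy_mul (hG : IsGarsideSystem S Δ) {a b y c : G}
    (ha : a ∈ S) (hab : Greedy S a b)
    (hb : ∀ d ∈ S, LeftDvd (posMonoid S) d y → LeftDvd (posMonoid S) d b)
    (hc : c ∈ S) (hcy : LeftDvd (posMonoid S) c (a * y)) (hy : y ∈ posMonoid S) :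
    LeftDvd (posMonoid S) c a := by
  obtain ⟨m, hm, hcm, ham, hmin⟩ :=
    hG.lcmMonoid.exists_rightLcm c (hG.mem_pos hc) a (hG.mem_pos ha)
  have hmS : m ∈ S := hG.mem_iff.2
    ⟨hm, hmin _ hG.delta_mem (hG.mem_iff.1 hc).2 (hG.mem_iff.1 ha).2⟩
  have hmy := hmin _ (mul_mem (hG.mem_pos ha) hy) hcy ⟨y, hy, rfl⟩
  obtain ⟨d, hd, rfl⟩ := ham
  obtain ⟨e, he, h⟩ := hmy
  have hdS : d ∈ S := hG.mem_of_rightDvd hd hmS ⟨a, hG.mem_pos ha, rfl⟩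
  have hd1 : d = 1 := hab d hd
    (hb d hdS ⟨e, he, by rw [mul_assoc] at h; exact mul_left_cancel h⟩) hmS
  simpa [hd1] using hcm

lemma IsNF.leftDvd_head (hG : IsGarsideSystem S Δ) : ∀ {a : G} {t : List G},
    IsNF S Δ (a :: t) → ∀ c ∈ S, LeftDvd (posMonoid S) c (a :: t).prod →
      LeftDvd (posMonoid S) c a
  | a, [], _, c, _, h => by simpa using h
  | a, b :: t, ht, c, hc, h => by
    have ht' : IsNF S Δ (b :: t) := ⟨fun x hx => ht.1 x (by simp [hx]), ht.2.tail⟩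
    rw [List.prod_cons] at h
    exact leftDvd_greedy_mul hG (ht.1 a (by simp)).1 (List.isChain_cons_cons.1 ht.2).1
      (fun d hd hdy => ht'.leftDvd_head hG d hd hdy) hc h (prod_mem_of_proper hG ht'.1)

lemma IsNF.not_delta_leftDvd (hG : IsGarsideSystem S Δ) (hℓ : IsLengthFun S ℓ) {t : List G}
    (ht : IsNF S Δ t) (hΔ : Δ ≠ 1) : ¬ LeftDvd (posMonoid S) Δ t.prod := by
  cases t with
  | nil =>
    rintro ⟨c, hc, h⟩
    exact hΔ (eq_one_of_mul_eq_one hG hℓ hG.delta_mem hc h.symm)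
  | cons a t =>
    intro h
    have h1 := ht.leftDvd_head hG Δ hG.delta_mem_simple h
    have h2 := ht.1 a (by simp)
    have := LeftDvd.antisymm hG hℓ h1 (hG.mem_iff.1 h2.1).2
    exact h2.2 (by simp [← this])

lemma IsNF.eq_of_prod_eq (hG : IsGarsideSystem S Δ) (hℓ : IsLengthFun S ℓ) :
    ∀ {t t' : List G}, IsNF S Δ t → IsNF S Δ t' → t.prod = t'.prod → t = t'
  | [], [], _, _, _ => rfl
  | [], a :: t, _, ht, h => by
    rw [List.prod_nil, List.prod_cons] at h
    have ha := ht.1 a (by simp)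
    have := eq_one_of_mul_eq_one hG hℓ (hG.mem_pos ha.1)
      (prod_mem_of_proper hG fun x hx => ht.1 x (by simp [hx])) h.symm
    exact absurd (by simp [this]) ha.2
  | a :: t, [], ht, _, h => by
    rw [List.prod_nil, List.prod_cons] at h
    have ha := ht.1 a (by simp)
    have := eq_one_of_mul_eq_one hG hℓ (hG.mem_pos ha.1)
      (prod_mem_of_proper hG fun x hx => ht.1 x (by simp [hx])) h
    exact absurd (by simp [this]) ha.2
  | a :: t, b :: t', ht, ht', h => by
    have hta : IsNF S Δ t := ⟨fun x hx => ht.1 x (by simp [hx]), ht.2.tail⟩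
    have htb : IsNF S Δ t' := ⟨fun x hx => ht'.1 x (by simp [hx]), ht'.2.tail⟩
    have hab : LeftDvd (posMonoid S) a b := ht'.leftDvd_head hG a (ht.1 a (by simp)).1
      (by rw [← h]; exact ⟨t.prod, prod_mem_of_proper hG hta.1, List.prod_cons⟩)
    have hba : LeftDvd (posMonoid S) b a := ht.leftDvd_head hG b (ht'.1 b (by simp)).1
      (by rw [h]; exact ⟨t'.prod, prod_mem_of_proper hG htb.1, List.prod_cons⟩)
    obtain rfl := LeftDvd.antisymm hG hℓ hab hba
    rw [List.prod_cons, List.prod_cons] at h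
    rw [hta.eq_of_prod_eq hG hℓ htb (mul_left_cancel h)]

/-- A larger exponent on the right would make Δ a left divisor of `t.prod`, hence of its first
factor, which is proper. -/
lemma IsNF.exponent_le (hG : IsGarsideSystem S Δ) (hℓ : IsLengthFun S ℓ) (hΔ : Δ ≠ 1)
    {t t' : List G} (ht : IsNF S Δ t) (ht' : IsNF S Δ t') {p q : ℤ}
    (h : Δ ^ p * t.prod = Δ ^ q * t'.prod) : q ≤ p := by
  by_contra hlt
  obtain ⟨k, hk⟩ : ∃ k : ℕ, q = p + (k + 1 : ℕ) := ⟨(q - p - 1).toNat, by omega⟩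
  refine ht.not_delta_leftDvd hG hℓ hΔ
    ⟨Δ ^ k * t'.prod, mul_mem (pow_mem hG.delta_mem k) (prod_mem_of_proper hG ht'.1), ?_⟩
  rw [hk, zpow_add, mul_assoc, zpow_natCast, pow_succ', mul_assoc] at h
  exact mul_left_cancel h

lemma IsNF.unique (hG : IsGarsideSystem S Δ) (hℓ : IsLengthFun S ℓ) (hΔ : Δ ≠ 1)
    {t t' : List G} (ht : IsNF S Δ t) (ht' : IsNF S Δ t') {p q : ℤ}
    (h : Δ ^ p * t.prod = Δ ^ q * t'.prod) : p = q ∧ t = t' := by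
  have hpq : p = q := le_antisymm (ht'.exponent_le hG hℓ hΔ ht h.symm)
    (ht.exponent_le hG hℓ hΔ ht' h)
  subst hpq
  exact ⟨rfl, ht.eq_of_prod_eq hG hℓ ht' (mul_left_cancel h)⟩

/-! ### From left normal forms to `IsNF` -/

/-- A factor 1 followed by b would, being the gcd of Δ with the rest, be divisible by b, so
triviality would spread to the last factor. -/
lemma IsLeftNormalForm.ne_one {p : ℤ} {s : List G}
    (hG : IsGarsideSystem S Δ) (hℓ : IsLengthFun S ℓ) (h : IsLeftNormalForm S Δ p s) :
    ∀ t : List G, t <:+ s → ∀ x ∈ t.head?, x ≠ 1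
  | [], _, x, hx => by simp at hx
  | [a], hs, x, hx => by
    obtain ⟨r, rfl⟩ := hs
    have := h.getLast_ne_one (by simp)
    simp only [List.head?_cons, Option.mem_some_iff] at hx
    simpa [← hx] using this
  | a :: b :: t, hs, x, hx => by
    simp only [List.head?_cons, Option.mem_some_iff] at hx
    subst hx
    rintro rfl
    have hs' : b :: t <:+ s := (List.suffix_cons _ _).trans hs
    have hb := h.ne_one hG hℓ (b :: t) hs' b rfl
    have hbS : b ∈ S := h.simple b (hs'.subset (by simp))
    have htP : t.prod ∈ posMonoid S := Submonoid.list_prod_mem _ fun x hx =>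
      hG.mem_pos (h.simple x (hs'.subset (by simp [hx])))
    obtain ⟨c, hc, h1⟩ := (h.greedy 1 (b :: t) hs).2.2.2 b (hG.mem_pos hbS)
      (hG.mem_iff.1 hbS).2 ⟨t.prod, htP, by simp⟩
    exact hb (eq_one_of_mul_eq_one hG hℓ (hG.mem_pos hbS) hc h1.symm)

/-- For Δ = 1 all powers of Δ coincide and no greatest exponent exists. This rules out the
degenerate case, where exponents are not unique. -/
lemma IsLeftNormalForm.delta_ne_one {p : ℤ} {s : List G} (h : IsLeftNormalForm S Δ p s) :
    Δ ≠ 1 := by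
  rintro rfl
  have h1 : TwoSidedLE (posMonoid S) ((1 : G) ^ p) (1 ^ p * s.prod) := h.isGreatest_inf.1
  have h2 : p + 1 ≤ p := h.isGreatest_inf.2 (by simpa using h1)
  omega

/-- A factor Δ could be carried to the left and would raise the exponent. -/
lemma IsLeftNormalForm.delta_notMem {p : ℤ} {s : List G} (hG : IsGarsideSystem S Δ)
    (h : IsLeftNormalForm S Δ p s) : Δ ∉ s := by
  intro hs
  obtain ⟨u, v, rfl⟩ := List.append_of_mem hs
  have huP : u.prod ∈ posMonoid S := Submonoid.list_prod_mem _ fun x hx =>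
    hG.mem_pos (h.simple x (by simp [hx]))
  have hvP : v.prod ∈ posMonoid S := Submonoid.list_prod_mem _ fun x hx =>
    hG.mem_pos (h.simple x (by simp [hx]))
  have h2 : p + 1 ≤ p := h.isGreatest_inf.2
    ⟨1, one_mem _, twist Δ (-1) u.prod * v.prod,
      mul_mem ((twist_mem_pos_iff hG _).2 huP) hvP, by
        rw [twist_neg_one, List.prod_append, List.prod_cons]; group⟩
  omega

lemma IsLeftNormalForm.isChain {p : ℤ} {s : List G}
    (hG : IsGarsideSystem S Δ) (hℓ : IsLengthFun S ℓ) (h : IsLeftNormalForm S Δ p s) :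
    ∀ t : List G, t <:+ s → t.IsChain (Greedy S)
  | [], _ => by simp
  | [a], _ => by simp
  | a :: b :: t, hs => by
    have hs' : b :: t <:+ s := (List.suffix_cons _ _).trans hs
    refine List.isChain_cons_cons.2 ⟨fun c hc hcb hac => ?_, h.isChain hG hℓ _ hs'⟩
    have htP : t.prod ∈ posMonoid S := Submonoid.list_prod_mem _ fun x hx =>
      hG.mem_pos (h.simple x (hs'.subset (by simp [hx])))
    obtain ⟨d, hd, rfl⟩ := hcb
    obtain ⟨e, he, h1⟩ := (h.greedy a (c * d :: t) hs).2.2.2 (a * c) (hG.mem_pos hac)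
      (hG.mem_iff.1 hac).2 ⟨d * t.prod, mul_mem hd htP, by rw [List.prod_cons]; group⟩
    have : c * e = 1 := by
      rw [mul_assoc] at h1
      exact mul_eq_left.1 h1.symm
    exact eq_one_of_mul_eq_one hG hℓ hc he this

lemma IsLeftNormalForm.isNF {p : ℤ} {s : List G}
    (hG : IsGarsideSystem S Δ) (hℓ : IsLengthFun S ℓ) (h : IsLeftNormalForm S Δ p s) :
    IsNF S Δ s := by
  refine ⟨fun x hx => ⟨h.simple x hx, ?_⟩, h.isChain hG hℓ s List.suffix_rfl⟩
  obtain ⟨u, v, hs⟩ := List.append_of_mem hx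
  have h1 := h.ne_one hG hℓ (x :: v) ⟨u, hs.symm⟩ x rfl
  have h2 := h.delta_notMem hG
  simp only [Set.mem_insert_iff, Set.mem_singleton_iff, not_or]
  exact ⟨h1, fun hx' => h2 (hx' ▸ hx)⟩

/-! ### Consequences of the spindle condition -/

/-- Write Δ = m * e, m = a * x = b * y. The simple elements x * e and y * e share the right divisor
e ≠ 1, so their right gcd is one of the two. One complement then right-divides the other, which
compares a and b. -/
lemma leftDvd_total (hG : IsGarsideSystem S Δ) (hs : IsSpindleType S) {a b m : G}
    (ha : a ∈ posMonoid S) (hb : b ∈ posMonoid S) (hm : m ∈ S) (hmΔ : m ≠ Δ)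
    (ham : LeftDvd (posMonoid S) a m) (hbm : LeftDvd (posMonoid S) b m)
    (hℓ : IsLengthFun S ℓ) :
    LeftDvd (posMonoid S) a b ∨ LeftDvd (posMonoid S) b a := by
  obtain ⟨e, he, hΔ⟩ := (hG.mem_iff.1 hm).2
  obtain ⟨x, hx, hax⟩ := ham
  obtain ⟨y, hy, hby⟩ := hbm
  have hxS : x * e ∈ S := hG.mem_iff_right.2 ⟨mul_mem hx he, a, ha, by rw [hΔ, hax, mul_assoc]⟩
  have hyS : y * e ∈ S := hG.mem_iff_right.2 ⟨mul_mem hy he, b, hb, by rw [hΔ, hby, mul_assoc]⟩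
  have hxy : a * (x * e) = b * (y * e) := by rw [← mul_assoc, ← mul_assoc, ← hax, ← hby]
  obtain ⟨-, d, hd, -, h1, h2, h3⟩ := hs _ hxS _ hyS
  rcases hd with rfl | rfl | hd
  · obtain ⟨c, hc, h⟩ := h2
    right
    refine ⟨c, hc, mul_right_cancel (b := x * e) ?_⟩
    rw [hxy, h, mul_assoc]
  · obtain ⟨c, hc, h⟩ := h1
    left
    refine ⟨c, hc, mul_right_cancel (b := y * e) ?_⟩
    rw [← hxy, h, mul_assoc]
  · rw [Set.mem_singleton_iff] at hd
    subst hd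
    obtain ⟨c, hc, h⟩ := h3 e he ⟨x, hx, rfl⟩ ⟨y, hy, rfl⟩
    have hc1 : c = 1 := eq_one_of_mul_eq_one hG hℓ hc he h.symm
    rw [hc1, one_mul] at h
    exact absurd (by rw [hΔ, ← h, mul_one]) hmΔ

/-- A left divisor c of `a * u` is comparable with a. If c divides a, greediness of (x, a) applies;
if a divides c, then x * a is simple as well, which would force a = 1. -/
lemma greedy_mul_of_mem (hG : IsGarsideSystem S Δ) (hs : IsSpindleType S)
    (hℓ : IsLengthFun S ℓ) {x a u : G} (hxa : Greedy S x a) (hx : x ∈ posMonoid S)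
    (ha : a ∈ S \ {1, Δ}) (hu : u ∈ posMonoid S) (hau : a * u ∈ S) (hne : a * u ≠ Δ) :
    Greedy S x (a * u) := by
  intro c hc hcau hxc
  rcases leftDvd_total hG hs hc (hG.mem_pos ha.1) hau hne hcau ⟨u, hu, rfl⟩ hℓ with h | h
  · exact hxa c hc h hxc
  · obtain ⟨d, hd, rfl⟩ := h
    have : a = 1 := hxa a (hG.mem_pos ha.1) ⟨1, one_mem _, by simp⟩
      (hG.mem_of_leftDvd (mul_mem hx (hG.mem_pos ha.1)) hxc ⟨d, hd, by group⟩)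
    exact absurd (by simp [this]) ha.2

lemma IsNF.replace_last (hG : IsGarsideSystem S Δ) (hs : IsSpindleType S)
    (hℓ : IsLengthFun S ℓ) {t : List G} {a u : G} (h : IsNF S Δ (t ++ [a]))
    (hu : u ∈ posMonoid S) (hau : a * u ∈ S) (hne : a * u ≠ Δ) : IsNF S Δ (t ++ [a * u]) := by
  obtain ⟨h1, h2, h3⟩ := isNF_append_singleton.1 h
  refine isNF_append_singleton.2 ⟨h1, ⟨hau, ?_⟩, fun x hx => ?_⟩
  · simp only [Set.mem_insert_iff, Set.mem_singleton_iff, not_or]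
    refine ⟨fun h => h2.2 ?_, hne⟩
    simp [eq_one_of_mul_eq_one hG hℓ (hG.mem_pos h2.1) hu h]
  · exact greedy_mul_of_mem hG hs hℓ (h3 x hx)
      (hG.mem_pos (h1.1 x (List.mem_of_mem_getLast? hx)).1) h2 hu hau hne

lemma prod_mul_delta (t : List G) : t.prod * Δ = Δ * (t.map (twist Δ (-1))).prod := by
  rw [prod_map_twist]; group

/-- The left gcd of the complement a⁻¹Δ of the last factor with u has three possible values: if it
is a⁻¹Δ, then a * u = Δ * v and v, conjugated by Δ, is passed on to the shorter list; if it is u,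
then a * u is simple; if it is 1, then (a, u) is greedy and u is appended. -/
lemma IsNF.mul_simple (hG : IsGarsideSystem S Δ) (hs : IsSpindleType S)
    (hℓ : IsLengthFun S ℓ) (t : List G) : IsNF S Δ t → ∀ u ∈ S \ {1, Δ},
    ∃ (p : ℤ) (t' : List G), IsNF S Δ t' ∧ t.prod * u = Δ ^ p * t'.prod ∧
      ((p = 0 ∧ t' = t ++ [u]) ∨ t'.length ≤ t.length) := by
  induction t using List.reverseRecOn with
  | nil =>
    intro _ u hu
    exact ⟨0, [u], ⟨by simpa using hu, by simp⟩, by simp, by simp⟩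
  | append_singleton t a ih =>
    intro h u hu
    obtain ⟨h1, h2, h3⟩ := isNF_append_singleton.1 h
    have haS := hG.compl_mem h2.1
    have hdelta : a * u = Δ → ∃ (p : ℤ) (t' : List G), IsNF S Δ t' ∧
        (t ++ [a]).prod * u = Δ ^ p * t'.prod ∧
        ((p = 0 ∧ t' = t ++ [a] ++ [u]) ∨ t'.length ≤ (t ++ [a]).length) := fun hau =>
      ⟨1, t.map (twist Δ (-1)), h1.map_twist hG _, by
        rw [List.prod_append, List.prod_singleton, mul_assoc, hau, prod_mul_delta, zpow_one],
        Or.inr (by simp)⟩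
    obtain ⟨⟨d, hd, hdP, hda, hdu, hmax⟩, -⟩ := hs _ haS _ hu.1
    rcases hd with rfl | rfl | hd
    · obtain ⟨v, hv, rfl⟩ := hdu
      by_cases hv1 : v = 1
      · exact hdelta (by rw [hv1]; group)
      have hvS : v ∈ S := hG.mem_of_rightDvd hv hu.1 ⟨_, hG.mem_pos haS, rfl⟩
      have hvΔ : v ≠ Δ := by
        rintro rfl
        have := (length_lt_delta hG hℓ hu).2
        rw [hℓ.map_mul _ (hG.mem_pos haS) _ hv] at this
        have := length_nonneg hG hℓ (hG.mem_pos haS)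
        omega
      obtain ⟨p, t', ht', hprod, hlen⟩ := ih h1 (twist Δ 1 v)
        ((twist_mem_proper_iff hG 1).2 ⟨hvS, by simp [hv1, hvΔ]⟩)
      refine ⟨p + 1, t'.map (twist Δ (-1)), ht'.map_twist hG _, ?_, Or.inr ?_⟩
      · have : (t ++ [a]).prod * (a⁻¹ * Δ * v) = t.prod * twist Δ 1 v * Δ := by
          rw [List.prod_append, List.prod_singleton, twist_apply]; group
        rw [this, hprod, mul_assoc, prod_mul_delta, zpow_add, zpow_one, mul_assoc]
      · rcases hlen with ⟨-, rfl⟩ | hlen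
        · simp
        · simp; omega
    · obtain ⟨e, he, hae⟩ := hda
      have hauΔ : Δ = a * d * e := by rw [mul_assoc, ← hae]; group
      by_cases hau : a * d = Δ
      · exact hdelta hau
      · exact ⟨0, t ++ [a * d], h.replace_last hG hs hℓ hdP (hG.mem_iff.2
          ⟨mul_mem (hG.mem_pos h2.1) hdP, e, he, hauΔ⟩) hau, by simp [mul_assoc],
          Or.inr (by simp)⟩
    · rw [Set.mem_singleton_iff] at hd
      subst hd
      refine ⟨0, t ++ [a] ++ [u], isNF_append_singleton.2 ⟨h, hu, fun x hx c hc hcu hxc => ?_⟩,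
        by simp [mul_assoc], Or.inl ⟨rfl, rfl⟩⟩
      simp only [List.getLast?_append, List.getLast?_singleton, Option.some_or,
        Option.mem_some_iff] at hx
      subst hx
      obtain ⟨e, he, hΔ⟩ := (hG.mem_iff.1 hxc).2
      obtain ⟨f, hf, h⟩ := hmax c hc ⟨e, he, by rw [hΔ]; group⟩ hcu
      exact eq_one_of_mul_eq_one hG hℓ hc hf h.symm

/-- The alternative is the point: once a single multiplication fails to append, a factor is lost for
good. -/
lemma exists_isNF (hG : IsGarsideSystem S Δ) (hs : IsSpindleType S)
    (hℓ : IsLengthFun S ℓ) (t : List G) : (∀ x ∈ t, x ∈ S \ {1, Δ}) →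
    ∃ (p : ℤ) (t' : List G), IsNF S Δ t' ∧ t.prod = Δ ^ p * t'.prod ∧
      ((p = 0 ∧ t' = t) ∨ t'.length < t.length) := by
  induction t using List.reverseRecOn with
  | nil => exact fun _ => ⟨0, [], ⟨by simp, by simp⟩, by simp, by simp⟩
  | append_singleton t a ih =>
    intro h
    obtain ⟨p, t', ht', hprod, hlen⟩ := ih fun x hx => h x (by simp [hx])
    obtain ⟨q, t'', ht'', hprod', hlen'⟩ := ht'.mul_simple hG hs hℓ t' a (h a (by simp))
    refine ⟨p + q, t'', ht'', ?_, ?_⟩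
    · rw [List.prod_append, List.prod_singleton, hprod, mul_assoc, hprod', zpow_add, mul_assoc]
    · rcases hlen with ⟨rfl, rfl⟩ | hlen
      · rcases hlen' with ⟨rfl, rfl⟩ | hlen'
        · simp
        · right; simp; omega
      · right
        rcases hlen' with ⟨rfl, rfl⟩ | hlen'
        · simp; omega
        · simp; omega

/-- A product of at most as many proper simple elements as in the normal form is the normal
form. -/
lemma IsNF.length_le (hG : IsGarsideSystem S Δ) (hs : IsSpindleType S)
    (hℓ : IsLengthFun S ℓ) (hΔ : Δ ≠ 1) {t t' : List G} {p q : ℤ} (ht' : IsNF S Δ t')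
    (ht : ∀ x ∈ t, x ∈ S \ {1, Δ}) (h : Δ ^ q * t.prod = Δ ^ p * t'.prod) :
    t'.length ≤ t.length ∧ (t.length ≤ t'.length → q = p ∧ t = t') := by
  obtain ⟨r, t'', ht'', hprod, hlen⟩ := exists_isNF hG hs hℓ t ht
  rw [hprod, ← mul_assoc, ← zpow_add] at h
  obtain ⟨hr, rfl⟩ := ht''.unique hG hℓ hΔ ht' h
  rcases hlen with ⟨rfl, rfl⟩ | hlen
  · exact ⟨le_rfl, fun _ => ⟨by omega, rfl⟩⟩
  · exact ⟨hlen.le, fun h => by omega⟩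

/-! ### Inverse words and powers of words -/

@[simp] lemma eval_invRev (w : Word G) : eval (FreeGroup.invRev w) = (eval w)⁻¹ := by
  induction w with
  | nil => simp [FreeGroup.invRev]
  | cons y w ih =>
    obtain ⟨x, b⟩ := y
    have : FreeGroup.invRev ((x, b) :: w) = FreeGroup.invRev w ++ [(x, !b)] := by
      simp [FreeGroup.invRev]
    rw [this, eval_append, ih, eval_cons]
    cases b <;> simp [eval]

lemma isWord_invRev {A : Type*} {X : Set A} {w : Word A} (h : IsWord X w) : IsWord X (FreeGroup.invRev w) := by
  intro y hy
  simp only [FreeGroup.invRev, List.mem_reverse, List.mem_map] at hy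
  obtain ⟨z, hz, rfl⟩ := hy
  exact h z hz

lemma IsNegWord.invRev {A : Type*} {X : Set A} {w : Word A} (h : IsNegWord X w) :
    IsPosWord X (FreeGroup.invRev w) := by
  intro y hy
  simp only [FreeGroup.invRev, List.mem_reverse, List.mem_map] at hy
  obtain ⟨z, hz, rfl⟩ := hy
  exact ⟨(h z hz).1, by simp [(h z hz).2]⟩

lemma IsPosWord.invRev {A : Type*} {X : Set A} {w : Word A} (h : IsPosWord X w) :
    IsNegWord X (FreeGroup.invRev w) := by
  intro y hy
  simp only [FreeGroup.invRev, List.mem_reverse, List.mem_map] at hy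
  obtain ⟨z, hz, rfl⟩ := hy
  exact ⟨(h z hz).1, by simp [(h z hz).2]⟩

lemma IsPosWord.isWord {A : Type*} {X : Set A} {w : Word A} (h : IsPosWord X w) : IsWord X w :=
  fun y hy => (h y hy).1

lemma IsLengthFun.eval_neg (hℓ : IsLengthFun S ℓ) {w : Word G} (hw : IsNegWord (atoms S) w) :
    ℓ (SpindleGarside.eval w)⁻¹ = w.length := by
  rw [← eval_invRev, hℓ.eval hw.invRev]
  simp

lemma eval_replicate_flatten (n : ℕ) (w : Word G) :
    eval (List.replicate n w).flatten = eval w ^ n := by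
  induction n with
  | zero => simp
  | succ n ih => rw [List.replicate_succ, List.flatten_cons, eval_append, ih, pow_succ']

lemma eval_wordPow (D : Word G) (r : ℤ) : eval (wordPow D r) = eval D ^ r := by
  rw [wordPow, eval_replicate_flatten]
  split_ifs with h
  · lift r to ℕ using h
    simp
  · obtain ⟨n, rfl⟩ : ∃ n : ℕ, r = -n := ⟨(-r).toNat, by omega⟩
    simp

lemma length_wordPow {A : Type*} (D : Word A) (r : ℤ) : ((wordPow D r).length : ℤ) = |r| * D.length := by
  rw [wordPow]
  split_ifs <;> simp

lemma isWord_wordPow {A : Type*} {X : Set A} {D : Word A} (hD : IsWord X D) (r : ℤ) :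
    IsWord X (wordPow D r) := by
  intro y hy
  simp only [wordPow, List.mem_flatten, List.mem_replicate] at hy
  obtain ⟨l, ⟨-, rfl⟩, hy⟩ := hy
  split_ifs at hy
  · exact hD y hy
  · exact isWord_invRev hD y hy

/-! ### From signed blocks to positive factors -/

/-- `Conv S Δ L n t`: the blocks of `L`, `n` of which are negative, have product
`Δ ^ (-n)` times the product of the simple elements in `t`; these arise from the blocks by
moving the factors `Δ⁻¹` to the left. -/
inductive Conv (S : Set G) (Δ : G) : List (Word G) → ℕ → List G → Prop
  | nil : Conv S Δ [] 0 []
  | pos {u : Word G} {L : List (Word G)} {n : ℕ} {t : List G} (hu : IsPosBlock S Δ u)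
      (h : Conv S Δ L n t) : Conv S Δ (u :: L) n (twist Δ n (eval u) :: t)
  | neg {u : Word G} {L : List (Word G)} {n : ℕ} {t : List G} (hu : IsNegBlock S Δ u)
      (h : Conv S Δ L n t) : Conv S Δ (u :: L) (n + 1) (twist Δ n (Δ * eval u) :: t)

lemma exists_conv (L : List (Word G)) (h : ∀ u ∈ L, IsPosBlock S Δ u ∨ IsNegBlock S Δ u) :
    ∃ n t, Conv S Δ L n t := by
  induction L with
  | nil => exact ⟨0, [], .nil⟩
  | cons u L ih =>
    obtain ⟨n, t, hc⟩ := ih fun v hv => h v (by simp [hv])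
    rcases h u (by simp) with hu | hu
    · exact ⟨_, _, .pos hu hc⟩
    · exact ⟨_, _, .neg hu hc⟩

lemma IsNegBlock.delta_mul (hG : IsGarsideSystem S Δ) {u : Word G} (hu : IsNegBlock S Δ u) :
    Δ * eval u ∈ S \ {1, Δ} := by
  refine ⟨by simpa using hG.compl_mem_left hu.2.1, ?_⟩
  have h := hu.2.2
  simp only [Set.mem_insert_iff, Set.mem_singleton_iff, not_or] at h ⊢
  refine ⟨fun h' => h.2 ?_, fun h' => h.1 ?_⟩
  · exact (eq_inv_of_mul_eq_one_left h').symm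
  · simpa using h'

namespace Conv

variable {L : List (Word G)} {n : ℕ} {t : List G}

lemma proper (hG : IsGarsideSystem S Δ) (h : Conv S Δ L n t) : ∀ x ∈ t, x ∈ S \ {1, Δ} := by
  induction h with
  | nil => simp
  | pos hu _ ih =>
    intro x hx
    rcases List.mem_cons.1 hx with rfl | hx
    · exact (twist_mem_proper_iff hG _).2 hu.2
    · exact ih x hx
  | neg hu _ ih =>
    intro x hx
    rcases List.mem_cons.1 hx with rfl | hx
    · exact (twist_mem_proper_iff hG _).2 (hu.delta_mul hG)
    · exact ih x hx

lemma length_eq (h : Conv S Δ L n t) : t.length = L.length := by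
  induction h with
  | nil => rfl
  | pos _ _ ih => simp [ih]
  | neg _ _ ih => simp [ih]

lemma blocks (h : Conv S Δ L n t) : ∀ u ∈ L, IsPosBlock S Δ u ∨ IsNegBlock S Δ u := by
  induction h with
  | nil => simp
  | pos hu _ ih => simpa [hu] using ih
  | neg hu _ ih => simpa [hu] using ih

lemma eval_flatten (h : Conv S Δ L n t) : eval L.flatten = Δ ^ (-(n : ℤ)) * t.prod := by
  induction h with
  | nil => simp
  | pos hu _ ih =>
    rw [List.flatten_cons, eval_append, ih, List.prod_cons, twist_apply]
    group
  | neg hu _ ih =>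
    rw [List.flatten_cons, eval_append, ih, List.prod_cons, twist_apply]
    push_cast
    group

lemma eq_zero (h : Conv S Δ L n t) : (∀ u ∈ L, ¬ IsNegBlock S Δ u) → n = 0 := by
  induction h with
  | nil => exact fun _ => rfl
  | pos _ _ ih => exact fun h => ih fun u hu => h u (by simp [hu])
  | neg hu _ _ => exact fun h => absurd hu (h _ (by simp))

lemma isWord (h : Conv S Δ L n t) : IsWord (atoms S) L.flatten := by
  intro y hy
  obtain ⟨u, hu, hy⟩ := List.mem_flatten.1 hy
  rcases h.blocks u hu with hu | hu
  · exact (hu.1 y hy).1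
  · exact (hu.1 y hy).1

end Conv

lemma IsPosBlock.ne_nil {u : Word G} (h : IsPosBlock S Δ u) : u ≠ [] := by
  rintro rfl
  exact h.2.2 (by simp)

lemma IsNegBlock.ne_nil {u : Word G} (h : IsNegBlock S Δ u) : u ≠ [] := by
  rintro rfl
  exact h.2.2 (by simp)

lemma IsPosBlock.not_append_eq {u u' v v' : Word G} (h : IsPosBlock S Δ u)
    (h' : IsNegBlock S Δ u') : v ++ u ≠ v' ++ u' := by
  intro heq
  have h1 := congrArg List.getLast? heq
  rw [List.getLast?_append_of_ne_nil _ h.ne_nil, List.getLast?_append_of_ne_nil _ h'.ne_nil,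
    List.getLast?_eq_getLast_of_ne_nil h.ne_nil, List.getLast?_eq_getLast_of_ne_nil h'.ne_nil,
    Option.some_inj] at h1
  have h2 := (h.1 _ (List.getLast_mem h.ne_nil)).2
  rw [h1, (h'.1 _ (List.getLast_mem h'.ne_nil)).2] at h2
  exact absurd h2 (by simp)

lemma IsPosBlock.not_isNegBlock {u : Word G} (h : IsPosBlock S Δ u) : ¬ IsNegBlock S Δ u :=
  fun h' => h.not_append_eq h' (v := []) (v' := []) rfl

/-- The prefixes are arbitrary because the powers of D in two decompositions may differ a priori.
Blocks are matched from the right: once the tails agree, so do the twists; the last letter decides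
the sign and homogeneity the block length, so the blocks coincide as suffixes. -/
lemma Conv.unique (hℓ : IsLengthFun S ℓ) {L : List (Word G)} {n : ℕ} {t : List G}
    (h : Conv S Δ L n t) : ∀ {L' : List (Word G)} {n' : ℕ} {v v' : Word G}, Conv S Δ L' n' t →
      v ++ L.flatten = v' ++ L'.flatten → L = L' ∧ n = n' := by
  induction h with
  | nil =>
    intro L' n' v v' h' _
    cases h'
    exact ⟨rfl, rfl⟩
  | @pos u L n t hu h ih =>
    intro L' n' v v' h' heq
    generalize ha : twist Δ n (SpindleGarside.eval u) = a at h'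
    cases h' with
    | @pos u' L' n' _ hu' h' =>
      rw [List.flatten_cons, List.flatten_cons, ← List.append_assoc, ← List.append_assoc] at heq
      obtain ⟨rfl, rfl⟩ := ih h' heq
      have heval := (twist Δ n).injective ha
      have hlen : u.length = u'.length := by
        have h1 := hℓ.eval hu.1
        rw [heval, hℓ.eval hu'.1] at h1
        exact_mod_cast h1.symm
      rw [(List.append_inj' (List.append_cancel_right heq) hlen).2]
      exact ⟨rfl, rfl⟩
    | @neg u' L' n' _ hu' h' =>
      rw [List.flatten_cons, List.flatten_cons, ← List.append_assoc, ← List.append_assoc] at heq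
      obtain ⟨rfl, rfl⟩ := ih h' heq
      exact absurd (List.append_cancel_right heq) (hu.not_append_eq hu')
  | @neg u L n t hu h ih =>
    intro L' n' v v' h' heq
    generalize ha : twist Δ n (Δ * SpindleGarside.eval u) = a at h'
    cases h' with
    | @pos u' L' n' _ hu' h' =>
      rw [List.flatten_cons, List.flatten_cons, ← List.append_assoc, ← List.append_assoc] at heq
      obtain ⟨rfl, rfl⟩ := ih h' heq
      exact absurd (List.append_cancel_right heq).symm (hu'.not_append_eq hu)
    | @neg u' L' n' _ hu' h' =>
      rw [List.flatten_cons, List.flatten_cons, ← List.append_assoc, ← List.append_assoc] at heq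
      obtain ⟨rfl, rfl⟩ := ih h' heq
      have heval := mul_left_cancel ((twist Δ n).injective ha)
      have hlen : u.length = u'.length := by
        have h1 := hℓ.eval_neg hu.1
        rw [heval, hℓ.eval_neg hu'.1] at h1
        exact_mod_cast h1.symm
      rw [(List.append_inj' (List.append_cancel_right heq) hlen).2]
      exact ⟨rfl, rfl⟩

lemma eval_tauWord (w : Word G) : eval (tauWord Δ w) = twist Δ (-1) (eval w) := by
  induction w with
  | nil => simp [tauWord]
  | cons y w ih =>
    have : tauWord Δ (y :: w) = (Δ⁻¹ * y.1 * Δ, y.2) :: tauWord Δ w := rfl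
    rw [this, eval_cons, eval_cons, ih, map_mul]
    congr 1
    split_ifs
    · rw [twist_neg_one]
    · rw [twist_neg_one]
      group

lemma IsPosBlock.tauWord (hG : IsGarsideSystem S Δ) {u : Word G} (hu : IsPosBlock S Δ u) :
    IsPosBlock S Δ (tauWord Δ u) := by
  refine ⟨fun y hy => ?_, ?_⟩
  · obtain ⟨z, hz, rfl⟩ := List.mem_map.1 hy
    exact ⟨by simpa [twist_neg_one] using twist_mem_atoms hG (-1) (hu.1 z hz).1, (hu.1 z hz).2⟩
  · rw [eval_tauWord]
    exact (twist_mem_proper_iff hG _).2 hu.2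

lemma IsNegBlock.tauWord (hG : IsGarsideSystem S Δ) {u : Word G} (hu : IsNegBlock S Δ u) :
    IsNegBlock S Δ (tauWord Δ u) := by
  refine ⟨fun y hy => ?_, ?_⟩
  · obtain ⟨z, hz, rfl⟩ := List.mem_map.1 hy
    exact ⟨by simpa [twist_neg_one] using twist_mem_atoms hG (-1) (hu.1 z hz).1, (hu.1 z hz).2⟩
  · rw [eval_tauWord, ← map_inv]
    exact (twist_mem_proper_iff hG _).2 hu.2

/-- One more Δ⁻¹ is released at u' and passes all blocks to its left; applying τ to those blocks
cancels the extra twist, so the simple factors stay the same. -/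
lemma Conv.convert (hG : IsGarsideSystem S Δ) {u u' : Word G} {L₂ : List (Word G)}
    (hu : IsPosBlock S Δ u) (hu' : IsNegBlock S Δ u') (h : Δ * eval u' = eval u) :
    ∀ (L₁ : List (Word G)) {n : ℕ} {t : List G}, Conv S Δ (L₁ ++ u :: L₂) n t →
      Conv S Δ (L₁.map (SpindleGarside.tauWord Δ) ++ u' :: L₂) (n + 1) t
  | [], n, t, hc => by
    rw [List.nil_append] at hc
    cases hc with
    | pos _ hc =>
      rw [← h]
      exact .neg hu' hc
    | neg h2 _ => exact absurd h2 hu.not_isNegBlock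
  | x :: L₁, n, t, hc => by
    rw [List.cons_append] at hc
    cases hc with
    | pos hx hc =>
      have := Conv.pos (hx.tauWord hG) (Conv.convert hG hu hu' h L₁ hc)
      rw [eval_tauWord, twist_twist] at this
      simpa using this
    | @neg _ _ n _ hx hc =>
      have := Conv.neg (hx.tauWord hG) (Conv.convert hG hu hu' h L₁ hc)
      have htwist : twist Δ ((n + 1 : ℕ) : ℤ) (Δ * eval (SpindleGarside.tauWord Δ x)) =
          twist Δ n (Δ * eval x) := by
        rw [eval_tauWord]
        simp only [twist_apply]
        push_cast
        group
      rwa [htwist] at this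

/-! ### The combinatorial cost of choosing signs -/

/-- `Cost δ ns k c`: if `k` of the positive blocks of lengths `ns` are replaced by negative blocks
of the complementary lengths, then the total length is `c`. -/
inductive Cost (δ : ℤ) : List ℤ → ℤ → ℤ → Prop
  | nil : Cost δ [] 0 0
  | pos {a : ℤ} {ns : List ℤ} {k c : ℤ} (h : Cost δ ns k c) : Cost δ (a :: ns) k (a + c)
  | neg {a : ℤ} {ns : List ℤ} {k c : ℤ} (h : Cost δ ns k c) :
      Cost δ (a :: ns) (k + 1) (δ - a + c)

namespace Cost

variable {δ : ℤ} {ns : List ℤ} {k c : ℤ}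

lemma of_eq {k' c' : ℤ} (h : Cost δ ns k c) (hk : k = k') (hc : c = c') : Cost δ ns k' c' :=
  hk ▸ hc ▸ h

lemma append_pos (h : Cost δ ns k c) (a : ℤ) : Cost δ (ns ++ [a]) k (c + a) := by
  induction h with
  | nil => exact of_eq (.pos .nil) rfl (by ring)
  | pos _ ih => exact of_eq (.pos ih) rfl (by ring)
  | neg _ ih => exact of_eq (.neg ih) rfl (by ring)

lemma append_neg (h : Cost δ ns k c) (a : ℤ) : Cost δ (ns ++ [a]) (k + 1) (c + (δ - a)) := by
  induction h with
  | nil => exact of_eq (.neg .nil) rfl (by ring)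
  | pos _ ih => exact of_eq (.pos ih) rfl (by ring)
  | neg _ ih => exact of_eq (.neg ih) rfl (by ring)

lemma of_append {a : ℤ} : ∀ {ns : List ℤ} {k c : ℤ}, Cost δ (ns ++ [a]) k c →
    Cost δ ns k (c - a) ∨ Cost δ ns (k - 1) (c - (δ - a))
  | [], k, c, h => by
    rw [List.nil_append] at h
    cases h with
    | pos h => cases h; exact Or.inl (of_eq .nil rfl (by ring))
    | neg h => cases h; exact Or.inr (of_eq .nil (by ring) (by ring))
  | b :: ns, k, c, h => by
    rw [List.cons_append] at h
    cases h with
    | pos h =>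
      rcases of_append h with h | h
      · exact Or.inl (of_eq (.pos h) (by ring) (by ring))
      · exact Or.inr (of_eq (.pos h) (by ring) (by ring))
    | neg h =>
      rcases of_append h with h | h
      · exact Or.inl (of_eq (.neg h) (by ring) (by ring))
      · exact Or.inr (of_eq (.neg h) (by ring) (by ring))

end Cost

/-- The number `m` is at least the length of some word obtained from the normal form with exponent
`p` and factors of lengths `ns` by making some of the factors negative. -/
def Reach (δ p : ℤ) (ns : List ℤ) (m : ℤ) : Prop :=
  ∃ k c, Cost δ ns k c ∧ |p + k| * δ + c ≤ m

namespace Reach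

variable {δ p : ℤ} {ns : List ℤ} {m : ℤ}

lemma append_one (h : Reach δ p ns m) : Reach δ p (ns ++ [1]) (m + 1) := by
  obtain ⟨k, c, hc, hm⟩ := h
  exact ⟨k, c + 1, hc.append_pos 1, by linarith⟩

lemma abs_mul_le {δ a b : ℤ} (hδ : 0 ≤ δ) (h : |a - b| = 1) : |a| * δ ≤ |b| * δ + δ := by
  have h1 : |a| ≤ |b| + 1 := by
    rw [← h]
    have := abs_sub_abs_le_abs_sub a b
    linarith
  have := mul_le_mul_of_nonneg_right h1 hδ
  linarith

/-- If the removed factor was negative, its δ - 1 letters are saved while the exponent changes by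
one, at a cost of at most δ: a net increase of at most 1. -/
lemma of_append_one (hδ : 0 ≤ δ) (h : Reach δ p (ns ++ [1]) m) : Reach δ p ns (m + 1) := by
  obtain ⟨k, c, hc, hm⟩ := h
  rcases hc.of_append with hc | hc
  · exact ⟨_, _, hc, by linarith⟩
  · refine ⟨_, _, hc, ?_⟩
    have := abs_mul_le (a := p + (k - 1)) (b := p + k) hδ (by ring_nf; norm_num)
    linarith

lemma change_last {a b : ℤ} (hab : |a - b| ≤ 1) (h : Reach δ p (ns ++ [a]) m) :
    Reach δ p (ns ++ [b]) (m + 1) := by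
  obtain ⟨k, c, hc, hm⟩ := h
  rw [abs_le] at hab
  rcases hc.of_append with hc | hc
  · exact ⟨_, _, hc.append_pos b, by linarith⟩
  · refine ⟨_, _, hc.append_neg b, ?_⟩
    rw [sub_add_cancel]
    linarith

/-- A positive last factor saves δ - 1 letters against a change of at most δ in the power of Δ. A
negative one saves its single letter, and its Δ is exactly the new unit of the exponent. -/
lemma remove_last (hδ : 0 ≤ δ) (h : Reach δ p (ns ++ [δ - 1]) m) :
    Reach δ (p + 1) ns (m + 1) := by
  obtain ⟨k, c, hc, hm⟩ := h
  rcases hc.of_append with hc | hc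
  · refine ⟨_, _, hc, ?_⟩
    have := abs_mul_le (a := p + 1 + k) (b := p + k) hδ (by ring_nf; norm_num)
    linarith
  · refine ⟨_, _, hc, ?_⟩
    rw [show p + 1 + (k - 1) = p + k by ring]
    linarith

lemma add_last (h : Reach δ (p + 1) ns m) : Reach δ p (ns ++ [δ - 1]) (m + 1) := by
  obtain ⟨k, c, hc, hm⟩ := h
  refine ⟨_, _, hc.append_neg _, ?_⟩
  rw [show p + (k + 1) = p + 1 + k by ring]
  linarith

lemma shift (hδ : δ = 1) {q : ℤ} (hpq : |p - q| = 1) (h : Reach δ p ns m) :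
    Reach δ q ns (m + 1) := by
  obtain ⟨k, c, hc, hm⟩ := h
  refine ⟨k, c, hc, ?_⟩
  have := abs_mul_le (δ := δ) (a := q + k) (b := p + k) (by omega)
    (by rw [abs_sub_comm, ← hpq]; ring_nf)
  linarith

end Reach

/-! ### The lower bound for arbitrary words -/

/-- The new last factor is one letter longer, is completed to Δ, or is the atom itself. Both
implications on `Reach` are kept, since the reverse one serves multiplication by inverses of atoms.
-/
lemma IsNF.mul_atom (hG : IsGarsideSystem S Δ) (hs : IsSpindleType S)
    (hℓ : IsLengthFun S ℓ) (hΔ : Δ ≠ 1) {t : List G} (ht : IsNF S Δ t) (p : ℤ) {x : G}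
    (hx : x ∈ atoms S) (hxS : x ∈ S) :
    ∃ (q : ℤ) (t' : List G), IsNF S Δ t' ∧ Δ ^ p * t.prod * x = Δ ^ q * t'.prod ∧
      ∀ m : ℤ, (Reach (ℓ Δ) p (t.map ℓ) m → Reach (ℓ Δ) q (t'.map ℓ) (m + 1)) ∧
        (Reach (ℓ Δ) q (t'.map ℓ) m → Reach (ℓ Δ) p (t.map ℓ) (m + 1)) := by
  have hδ : 0 ≤ ℓ Δ := length_nonneg hG hℓ hG.delta_mem
  have hx1 := hℓ.atom x hx
  have htwist : ∀ t : List G, IsNF S Δ t → (t.map (twist Δ (-1))).map ℓ = t.map ℓ := by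
    intro t ht
    rw [List.map_map]
    exact List.map_congr_left fun y hy => length_twist hG hℓ _ (hG.mem_pos (ht.1 y hy).1)
  by_cases hxΔ : x = Δ
  · subst hxΔ
    refine ⟨p + 1, t.map (twist x (-1)), ht.map_twist hG _, ?_, fun m => ?_⟩
    · rw [mul_assoc, prod_mul_delta, zpow_add, zpow_one, mul_assoc]
    · rw [htwist t ht]
      -- Here Δ is itself an atom, so δ = 1 and a change of the exponent by one costs one letter.
      exact ⟨fun h => h.shift hx1 (by ring_nf; norm_num),
        fun h => h.shift hx1 (by ring_nf; norm_num)⟩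
  have hxp : x ∈ S \ {1, Δ} := ⟨hxS, by simp [hx.2.1, hxΔ]⟩
  rcases List.eq_nil_or_concat' t with rfl | ⟨t, a, rfl⟩
  · refine ⟨p, [x], ⟨by simpa using hxp, by simp⟩, by simp, fun m => ?_⟩
    rw [List.map_singleton, hx1]
    exact ⟨fun h => h.append_one, fun h => h.of_append_one hδ⟩
  obtain ⟨h1, h2, h3⟩ := isNF_append_singleton.1 ht
  by_cases hax : a * x ∈ S
  · have hax1 : ℓ (a * x) = ℓ a + 1 := by rw [hℓ.map_mul _ (hG.mem_pos h2.1) _ hx.1, hx1]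
    by_cases haΔ : a * x = Δ
    · refine ⟨p + 1, t.map (twist Δ (-1)), h1.map_twist hG _, ?_, fun m => ?_⟩
      · have : Δ ^ p * (t ++ [a]).prod * x = Δ ^ p * (t.prod * (a * x)) := by
          rw [List.prod_append, List.prod_singleton]; group
        rw [this, haΔ, prod_mul_delta, zpow_add, zpow_one, mul_assoc]
      · rw [htwist t h1, List.map_append, List.map_singleton,
          show ℓ a = ℓ Δ - 1 by rw [← haΔ, hax1]; ring]
        exact ⟨fun h => h.remove_last hδ, fun h => h.add_last⟩
    · refine ⟨p, t ++ [a * x], ht.replace_last hG hs hℓ hx.1 hax haΔ, by simp [mul_assoc],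
        fun m => ?_⟩
      rw [List.map_append, List.map_append, List.map_singleton, List.map_singleton, hax1]
      exact ⟨fun h => h.change_last (by simp), fun h => h.change_last (by simp)⟩
  · refine ⟨p, t ++ [a] ++ [x], isNF_append_singleton.2 ⟨ht, hxp, fun y hy c hc hcx hyc => ?_⟩,
      by simp [mul_assoc], fun m => ?_⟩
    · simp only [List.getLast?_append, List.getLast?_singleton, Option.some_or,
        Option.mem_some_iff] at hy
      subst hy
      obtain ⟨d, hd, rfl⟩ := hcx
      -- A left divisor of an atom is 1 or the atom, and the latter contradicts that `a * x` is not
      -- simple.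
      rcases hx.2.2 c hc d hd rfl with h | h
      · exact h
      · exact absurd (by simpa [h] using hyc) hax
    · rw [List.map_append (l₁ := t ++ [a]), List.map_singleton, hx1]
      exact ⟨fun h => h.append_one, fun h => h.of_append_one hδ⟩

lemma IsGarsideSystem.atom_mem (hG : IsGarsideSystem S Δ) {x : G} (hx : x ∈ atoms S) :
    x ∈ S := by
  have key : ∀ a ∈ posMonoid S, a = 1 ∨ ∃ s ∈ S, s ≠ 1 ∧ LeftDvd (posMonoid S) s a := by
    intro a ha
    induction ha using Submonoid.closure_induction_left with
    | one => exact Or.inl rfl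
    | mul_left s hs y hy ih =>
      by_cases h1 : s = 1
      · simpa [h1] using ih
      · exact Or.inr ⟨s, hs, h1, y, hy, rfl⟩
  rcases key x hx.1 with h | ⟨s, hs, h1, c, hc, rfl⟩
  · exact absurd h hx.2.1
  · rcases hx.2.2 s (hG.mem_pos hs) c hc rfl with h | h
    · exact absurd h h1
    · simpa [h] using hs

lemma exists_reach_of_word (hG : IsGarsideSystem S Δ) (hs : IsSpindleType S)
    (hℓ : IsLengthFun S ℓ) (hΔ : Δ ≠ 1) (w : Word G) : IsWord (atoms S) w →
    ∃ (p : ℤ) (t : List G), IsNF S Δ t ∧ eval w = Δ ^ p * t.prod ∧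
      Reach (ℓ Δ) p (t.map ℓ) w.length := by
  induction w using List.reverseRecOn with
  | nil =>
    exact fun _ => ⟨0, [], ⟨by simp, by simp⟩, by simp, 0, 0, .nil, by simp⟩
  | append_singleton w y ih =>
    intro hw
    obtain ⟨p, t, ht, heval, hreach⟩ := ih fun z hz => hw z (by simp [hz])
    obtain ⟨x, b⟩ := y
    have hx : x ∈ atoms S := hw (x, b) (by simp)
    have hxS := hG.atom_mem hx
    cases b with
    | true =>
      obtain ⟨q, t', ht', h1, h2⟩ := ht.mul_atom hG hs hℓ hΔ p hx hxS
      refine ⟨q, t', ht', ?_, ?_⟩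
      · rw [← h1, ← heval]
        simp [eval]
      · simpa using (h2 _).1 hreach
    | false =>
      obtain ⟨q, t', ht', h1⟩ : ∃ (q : ℤ) (t' : List G), IsNF S Δ t' ∧
          Δ ^ p * t.prod * x⁻¹ = Δ ^ q * t'.prod := by
        have hmul : ∃ (q : ℤ) (t' : List G), IsNF S Δ t' ∧
          Δ ^ p * t.prod * (x⁻¹ * Δ) = Δ ^ q * t'.prod := by
          by_cases hxΔ : x = Δ
          · exact ⟨p, t, ht, by simp [hxΔ]⟩
          · obtain ⟨q, t', ht', h1, -⟩ := ht.mul_simple hG hs hℓ t (x⁻¹ * Δ)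
              ⟨hG.compl_mem hxS, by
                simp only [Set.mem_insert_iff, Set.mem_singleton_iff, not_or]
                exact ⟨fun h => hxΔ (inv_mul_eq_one.1 h), by simpa using hx.2.1⟩⟩
            exact ⟨p + q, t', ht', by rw [mul_assoc, h1, zpow_add, mul_assoc]⟩
        obtain ⟨q, t', ht', h1⟩ := hmul
        refine ⟨q - 1, t'.map (twist Δ 1), ht'.map_twist hG _, ?_⟩
        have : Δ ^ p * t.prod * x⁻¹ = Δ ^ p * t.prod * (x⁻¹ * Δ) * Δ⁻¹ := by group
        rw [this, h1, prod_map_twist]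
        group
      -- Multiplying the new normal form back by x returns the old one by uniqueness, so the reverse
      -- implication of `mul_atom` gives the bound.
      obtain ⟨p', t'', ht'', h2, h3⟩ := ht'.mul_atom hG hs hℓ hΔ q hx hxS
      rw [← h1, inv_mul_cancel_right] at h2
      obtain ⟨rfl, rfl⟩ := ht.unique hG hℓ hΔ ht'' h2
      refine ⟨q, t', ht', ?_, ?_⟩
      · rw [← h1, ← heval]
        simp [eval]
      · simpa using (h3 _).2 hreach

/-! ### Optimality of threshold choices -/

/-- Optimality of a choice of negative blocks governed by a length threshold `M`. -/
lemma Conv.length_le_cost (hG : IsGarsideSystem S Δ) (hℓ : IsLengthFun S ℓ)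
    {L : List (Word G)} {n : ℕ} {t : List G} (h : Conv S Δ L n t) {M : ℤ} :
    (∀ u ∈ L, IsPosBlock S Δ u → (u.length : ℤ) ≤ M) →
    (∀ u ∈ L, IsNegBlock S Δ u → (u.length : ℤ) ≤ ℓ Δ - M) → ∀ {k c : ℤ},
    Cost (ℓ Δ) (t.map ℓ) k c →
      (L.flatten.length : ℤ) + (2 * M - ℓ Δ) * n ≤ c + (2 * M - ℓ Δ) * k := by
  induction h with
  | nil =>
    intro _ _ k c hc
    cases hc
    simp
  | @pos u L n t hu h ih =>
    intro h1 h2 k c hc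
    have hlen : ℓ (twist Δ n (SpindleGarside.eval u)) = u.length := by
      rw [length_twist hG hℓ _ hu.1.eval_mem, hℓ.eval hu.1]
    have hM := h1 u (by simp) hu
    have ih' := @ih (fun v hv => h1 v (by simp [hv])) (fun v hv => h2 v (by simp [hv]))
    rw [List.map_cons, hlen] at hc
    rw [List.flatten_cons, List.length_append]
    push_cast
    -- With multiplier 2M - δ per negative factor, a factor of length a weighs a if positive and 2M
    -- - a if negative; positive is optimal as soon as a ≤ M.
    cases hc with
    | pos hc => linarith [ih' hc]
    | neg hc => linarith [ih' hc]
  | @neg u L n t hu h ih =>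
    intro h1 h2 k c hc
    have hlen : ℓ (twist Δ n (Δ * SpindleGarside.eval u)) = ℓ Δ - u.length := by
      have hP := hG.mem_pos (hu.delta_mul hG).1
      rw [length_twist hG hℓ _ hP, ← hℓ.eval_neg hu.1]
      have := hℓ.map_mul _ hP _ (hG.mem_pos hu.2.1)
      rw [mul_inv_cancel_right] at this
      omega
    have hM := h2 u (by simp) hu
    have ih' := @ih (fun v hv => h1 v (by simp [hv])) (fun v hv => h2 v (by simp [hv]))
    rw [List.map_cons, hlen] at hc
    rw [List.flatten_cons, List.length_append]
    push_cast
    cases hc with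
    | pos hc => linarith [ih' hc]
    | neg hc => linarith [ih' hc]

/-! ### Minimal decompositions and the reduction -/

lemma IsDecomposition.length_le (hG : IsGarsideSystem S Δ) (hs : IsSpindleType S)
    (hℓ : IsLengthFun S ℓ) (hΔ : Δ ≠ 1) {D w : Word G} (hD : eval D = Δ) {p r : ℤ} {t : List G}
    (ht : IsNF S Δ t) (hw : eval w = Δ ^ p * t.prod) {L : List (Word G)}
    (h : IsDecomposition S Δ D w r L) :
    t.length ≤ L.length ∧ (L.length ≤ t.length → ∃ n : ℕ, r = p + n ∧ Conv S Δ L n t) := by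
  obtain ⟨rfl, hL⟩ := h
  obtain ⟨n, t', hc⟩ := exists_conv L hL
  rw [eval_append, eval_wordPow, hc.eval_flatten, hD, ← mul_assoc, ← zpow_add] at hw
  have key := ht.length_le hG hs hℓ hΔ (hc.proper hG) hw
  rw [hc.length_eq] at key
  refine ⟨key.1, fun hle => ?_⟩
  obtain ⟨hr, rfl⟩ := key.2 hle
  exact ⟨n, by omega, hc⟩

/-- The words occurring in the reduction of a word for `Δ ^ p * t.prod`, together with their
minimal decompositions: the blocks of length below some threshold are positive and those whose
complement has length above it are negative. -/
structure IsReducing (S : Set G) (Δ : G) (D : Word G) (p : ℤ) (t : List G)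
    (w : Word G) (r : ℤ) (L : List (Word G)) (n : ℕ) (M : ℤ) : Prop where
  eq_word : w = wordPow D r ++ L.flatten
  conv : Conv S Δ L n t
  exponent : r = p + n
  threshold_nonneg : 0 ≤ M
  threshold_le : M ≤ D.length
  pos_le : ∀ u ∈ L, IsPosBlock S Δ u → (u.length : ℤ) ≤ M
  neg_le : ∀ u ∈ L, IsNegBlock S Δ u → (u.length : ℤ) ≤ D.length - M
  exponent_nonpos : r ≤ 0 ∨ ∀ u ∈ L, ¬ IsNegBlock S Δ u

namespace IsReducing

variable {D : Word G} {p r : ℤ} {t : List G} {w : Word G} {L : List (Word G)} {n : ℕ} {M : ℤ}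

lemma eval_eq (hD : eval D = Δ) (h : IsReducing S Δ D p t w r L n M) :
    eval w = Δ ^ p * t.prod := by
  rw [h.eq_word, eval_append, eval_wordPow, h.conv.eval_flatten, hD, h.exponent, ← mul_assoc,
    ← zpow_add, add_neg_cancel_right]

lemma isMinDecomposition (hG : IsGarsideSystem S Δ) (hs : IsSpindleType S)
    (hℓ : IsLengthFun S ℓ) (hΔ : Δ ≠ 1) (hD : eval D = Δ) (ht : IsNF S Δ t)
    (h : IsReducing S Δ D p t w r L n M) : IsMinDecomposition S Δ D w r L := by
  refine ⟨⟨h.eq_word, h.conv.blocks⟩, fun r' L' h' => ?_⟩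
  rw [← h.conv.length_eq]
  exact (h'.length_le hG hs hℓ hΔ hD ht (h.eval_eq hD)).1

lemma unique (hG : IsGarsideSystem S Δ) (hs : IsSpindleType S)
    (hℓ : IsLengthFun S ℓ) (hΔ : Δ ≠ 1) (hD : eval D = Δ) (ht : IsNF S Δ t)
    (h : IsReducing S Δ D p t w r L n M) {r' : ℤ} {L' : List (Word G)}
    (h' : IsMinDecomposition S Δ D w r' L') : r' = r ∧ L' = L := by
  obtain ⟨n', hr', hc⟩ := (h'.1.length_le hG hs hℓ hΔ hD ht (h.eval_eq hD)).2 (by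
    rw [h.conv.length_eq]
    exact h'.2 r L ⟨h.eq_word, h.conv.blocks⟩)
  obtain ⟨rfl, rfl⟩ := hc.unique hℓ h.conv (h'.1.1.symm.trans h.eq_word)
  exact ⟨hr'.trans h.exponent.symm, rfl⟩

/-- The multiplier 2M - δ must match the slope of the convex term |p + k|δ at k = n. At r = 0 every
value in [-δ, δ] is admissible; for r < 0 the slope is -δ, for r > 0 it is δ. -/
lemma geodesic (hG : IsGarsideSystem S Δ) (hs : IsSpindleType S)
    (hℓ : IsLengthFun S ℓ) (hΔ : Δ ≠ 1) (hD : eval D = Δ) (hDX : IsPosWord (atoms S) D)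
    (ht : IsNF S Δ t) (h : IsReducing S Δ D p t w r L n M)
    (hfin : 0 ≤ r ∨ ∀ u ∈ L, IsNegBlock S Δ u) {v : Word G} (hv : IsWord (atoms S) v)
    (hvw : eval v = eval w) : w.length ≤ v.length := by
  have hDlen : ℓ Δ = D.length := by rw [← hD, hℓ.eval hDX]
  obtain ⟨q, t', ht', hq, k, c, hc, hlen⟩ := exists_reach_of_word hG hs hℓ hΔ v hv
  obtain ⟨rfl, rfl⟩ := ht.unique hG hℓ hΔ ht' (by rw [← h.eval_eq hD, ← hvw, hq])
  have hr := h.exponent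
  have hwlen : (w.length : ℤ) = |r| * D.length + L.flatten.length := by
    rw [h.eq_word, List.length_append, Nat.cast_add, length_wordPow]
  suffices hsuff : (w.length : ℤ) ≤ v.length by exact_mod_cast hsuff
  refine le_trans ?_ hlen
  rw [hwlen, hDlen]
  rw [hDlen] at hc
  have hδ : (0 : ℤ) ≤ D.length := by positivity
  have key : ∀ {M : ℤ}, (∀ u ∈ L, IsPosBlock S Δ u → (u.length : ℤ) ≤ M) →
      (∀ u ∈ L, IsNegBlock S Δ u → (u.length : ℤ) ≤ D.length - M) →
      (L.flatten.length : ℤ) + (2 * M - D.length) * n ≤ c + (2 * M - D.length) * k := by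
    intro M h1 h2
    have := h.conv.length_le_cost hG hℓ (M := M) (k := k) (c := c) h1 (by rwa [hDlen])
      (by rwa [hDlen])
    rwa [hDlen] at this
  by_cases hr0 : r ≤ 0
  · rcases hfin with hfin | hfin
    · have hr1 : r = 0 := le_antisymm hr0 hfin
      have hk := key h.pos_le h.neg_le
      have hpk : p + k = k - n := by omega
      rw [hpk, hr1, abs_zero, zero_mul, zero_add]
      have h1 : (2 * M - D.length) * (k - n) ≤ |k - n| * D.length := by
        refine (le_abs_self _).trans ?_
        rw [abs_mul, mul_comm]
        refine mul_le_mul_of_nonneg_left ?_ (abs_nonneg _)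
        rw [abs_le]
        have := h.threshold_nonneg
        have := h.threshold_le
        constructor <;> linarith
      linarith
    -- No positive blocks remain, so the threshold may be lowered to 0, which gives the multiplier
    -- -δ.
    · have hk := key (M := 0) (fun u hu hu' => absurd (hfin u hu) hu'.not_isNegBlock)
        (fun u hu hu' => by
          have := h.neg_le u hu hu'
          have := h.threshold_nonneg
          linarith)
      rw [abs_of_nonpos hr0, hr]
      have h1 : -(p + k) * (D.length : ℤ) ≤ |p + k| * D.length :=
        mul_le_mul_of_nonneg_right (neg_le_abs _) hδ
      linarith
  · have hpos := h.exponent_nonpos.resolve_left hr0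
    have hn : n = 0 := h.conv.eq_zero hpos
    -- Without negative blocks the threshold may be raised to δ, which gives the multiplier δ.
    have hk := key (M := D.length) (fun u hu hu' => (h.pos_le u hu hu').trans h.threshold_le)
      (fun u hu hu' => absurd hu' (hpos u hu))
    rw [abs_of_pos (not_le.1 hr0), hr]
    have h1 : (p + k) * (D.length : ℤ) ≤ |p + k| * D.length :=
      mul_le_mul_of_nonneg_right (le_abs_self _) hδ
    subst hn
    push_cast at hk ⊢
    linarith

lemma redStep_of_final (hG : IsGarsideSystem S Δ) (hs : IsSpindleType S)
    (hℓ : IsLengthFun S ℓ) (hΔ : Δ ≠ 1) (hD : eval D = Δ) (ht : IsNF S Δ t)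
    (h : IsReducing S Δ D p t w r L n M) (hfin : 0 ≤ r ∨ ∀ u ∈ L, IsNegBlock S Δ u)
    {v : Word G} : RedStep S Δ D w v ↔ v = w := by
  constructor
  · rintro ⟨r', L', hmin, h' | ⟨hr', L₁, u, L₂, u', hL', hu, -⟩⟩
    · exact h'.2
    · obtain ⟨rfl, rfl⟩ := h.unique hG hs hℓ hΔ hD ht hmin
      rcases hfin with hfin | hfin
      · omega
      · exact absurd (hfin u (by simp [hL'])) hu.not_isNegBlock
  · rintro rfl
    exact ⟨r, L, h.isMinDecomposition hG hs hℓ hΔ hD ht, Or.inl ⟨hfin, rfl⟩⟩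

lemma redStep (hG : IsGarsideSystem S Δ) (hs : IsSpindleType S)
    (hℓ : IsLengthFun S ℓ) (hΔ : Δ ≠ 1) (hD : eval D = Δ) (hDX : IsPosWord (atoms S) D)
    (ht : IsNF S Δ t)
    (h : IsReducing S Δ D p t w r L n M) (hfin : ¬ (0 ≤ r ∨ ∀ u ∈ L, IsNegBlock S Δ u))
    {v : Word G} (hv : RedStep S Δ D w v) :
    ∃ L' n' M', IsReducing S Δ D p t v (r + 1) L' n' M' := by
  obtain ⟨r', L', hmin, h' | ⟨hr', L₁, u, L₂, u', hL', hu, humax, hu', rfl⟩⟩ := hv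
  · obtain ⟨rfl, rfl⟩ := h.unique hG hs hℓ hΔ hD ht hmin
    exact absurd h'.1 hfin
  · obtain ⟨rfl, rfl⟩ := h.unique hG hs hℓ hΔ hD ht hmin
    subst hL'
    have hDlen : ℓ Δ = D.length := by rw [← hD, hℓ.eval hDX]
    have hinv : (eval u')⁻¹ = (eval u)⁻¹ * Δ := by rw [← hu'.2.1]; group
    have hublock : IsNegBlock S Δ u' := by
      refine ⟨hu'.1, hinv ▸ ⟨hG.compl_mem hu.2.1, ?_⟩⟩
      have h2 := hu.2.2
      simp only [Set.mem_insert_iff, Set.mem_singleton_iff, not_or] at h2 ⊢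
      exact ⟨fun h => h2.2 (inv_mul_eq_one.1 h), by simpa using h2.1⟩
    have hulen : (u.length : ℤ) + u'.length = D.length := by
      rw [← hℓ.eval hu.1, ← hℓ.eval_neg hu'.1, hinv, ← hDlen,
        ← hℓ.map_mul _ hu.1.eval_mem _ (hG.mem_pos (hG.compl_mem hu.2.1))]
      congr 1
      group
    have huM := h.pos_le u (by simp) hu
    have hblocks := h.conv.blocks
    -- The new threshold is the length of the replaced block: it is maximal among the positive
    -- blocks, and u' has the complementary length.
    refine ⟨L₁.map (tauWord Δ) ++ u' :: L₂, n + 1, u.length, ?_, ?_, ?_, ?_, ?_, ?_, ?_, ?_⟩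
    · simp
    · exact h.conv.convert hG hu hublock hu'.2.1 L₁
    · rw [h.exponent]; push_cast; ring
    · positivity
    · omega
    · intro x hx hxpos
      rcases List.mem_append.1 hx with hx | hx
      · obtain ⟨y, hy, rfl⟩ := List.mem_map.1 hx
        have hypos : IsPosBlock S Δ y := (hblocks y (by simp [hy])).resolve_right
          fun hyneg => hxpos.not_isNegBlock (hyneg.tauWord hG)
        have := humax y (by simp [hy]) hypos
        simpa [tauWord] using this
      · rcases List.mem_cons.1 hx with rfl | hx
        · exact absurd hublock hxpos.not_isNegBlock
        · exact_mod_cast humax x (by simp [hx]) hxpos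
    · intro x hx hxneg
      rcases List.mem_append.1 hx with hx | hx
      · obtain ⟨y, hy, rfl⟩ := List.mem_map.1 hx
        have hyneg : IsNegBlock S Δ y := (hblocks y (by simp [hy])).resolve_left
          fun hypos => (hypos.tauWord hG).not_isNegBlock hxneg
        have := h.neg_le y (by simp [hy]) hyneg
        simp only [tauWord, List.length_map]
        omega
      · rcases List.mem_cons.1 hx with rfl | hx
        · omega
        · have := h.neg_le x (by simp [hx]) hxneg
          omega
    · left; omega

lemma exists_redStep (hG : IsGarsideSystem S Δ) (hs : IsSpindleType S)
    (hℓ : IsLengthFun S ℓ) (hΔ : Δ ≠ 1) (hD : eval D = Δ) (ht : IsNF S Δ t)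
    (h : IsReducing S Δ D p t w r L n M) : ∃ v, RedStep S Δ D w v := by
  by_cases hfin : 0 ≤ r ∨ ∀ u ∈ L, IsNegBlock S Δ u
  · exact ⟨w, (h.redStep_of_final hG hs hℓ hΔ hD ht hfin).2 rfl⟩
  push Not at hfin
  obtain ⟨hr, x, hx, hxneg⟩ := hfin
  obtain ⟨u, ⟨hu, hupos⟩, humax⟩ := Set.exists_max_image {u | u ∈ L ∧ IsPosBlock S Δ u}
    List.length ((List.finite_toSet L).subset fun u hu => hu.1)
    ⟨x, hx, (h.conv.blocks x hx).resolve_right hxneg⟩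
  obtain ⟨L₁, L₂, rfl⟩ := List.append_of_mem hu
  have hex : ∃ m : ℕ, ∃ v : Word G, v.length = m ∧ IsNegWord (atoms S) v ∧
      Δ * eval v = eval u := by
    obtain ⟨v, hv, hev⟩ := hG.exists_posWord (hG.mem_pos (hG.compl_mem hupos.2.1))
    refine ⟨_, FreeGroup.invRev v, rfl, hv.invRev, ?_⟩
    rw [eval_invRev, hev]
    group
  classical
  obtain ⟨v, hvlen, hv, hev⟩ := Nat.find_spec hex
  refine ⟨_, r, _, h.isMinDecomposition hG hs hℓ hΔ hD ht, Or.inr ⟨hr, L₁, u, L₂, v, rfl, hupos,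
    fun y hy hypos => humax y ⟨hy, hypos⟩, ⟨hv, hev, fun v' hv' hev' => ?_⟩, rfl⟩⟩
  rw [hvlen]
  exact Nat.find_min' hex ⟨v', rfl, hv', hev'⟩

lemma exists_step (hG : IsGarsideSystem S Δ) (hs : IsSpindleType S)
    (hℓ : IsLengthFun S ℓ) (hΔ : Δ ≠ 1) (hD : eval D = Δ) (hDX : IsPosWord (atoms S) D)
    (ht : IsNF S Δ t) (h : IsReducing S Δ D p t w r L n M) {m : ℕ}
    (hm : (0 ≤ r ∨ ∀ u ∈ L, IsNegBlock S Δ u) ∨ -r ≤ m + 1) {v : Word G}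
    (hv : RedStep S Δ D w v) : ∃ r' L' n' M', IsReducing S Δ D p t v r' L' n' M' ∧
      ((0 ≤ r' ∨ ∀ u ∈ L', IsNegBlock S Δ u) ∨ -r' ≤ m) := by
  by_cases hfin : 0 ≤ r ∨ ∀ u ∈ L, IsNegBlock S Δ u
  · obtain rfl := (h.redStep_of_final hG hs hℓ hΔ hD ht hfin).1 hv
    exact ⟨r, L, n, M, h, Or.inl hfin⟩
  · obtain ⟨L', n', M', h'⟩ := h.redStep hG hs hℓ hΔ hD hDX ht hfin hv
    exact ⟨r + 1, L', n', M', h', Or.inr (by have := hm.resolve_left hfin; omega)⟩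

lemma exists_iterRel (hG : IsGarsideSystem S Δ) (hs : IsSpindleType S)
    (hℓ : IsLengthFun S ℓ) (hΔ : Δ ≠ 1) (hD : eval D = Δ) (hDX : IsPosWord (atoms S) D)
    (ht : IsNF S Δ t) (m : ℕ) : ∀ {w : Word G} {r : ℤ} {L : List (Word G)} {n : ℕ} {M : ℤ},
    IsReducing S Δ D p t w r L n M →
      ((0 ≤ r ∨ ∀ u ∈ L, IsNegBlock S Δ u) ∨ -r ≤ m) →
      ∃ v, iterRel (RedStep S Δ D) m w v := by
  induction m with
  | zero => exact fun _ _ => ⟨_, rfl⟩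
  | succ m ih =>
    intro w r L n M h hm
    obtain ⟨w', hw'⟩ := h.exists_redStep hG hs hℓ hΔ hD ht
    obtain ⟨r', L', n', M', h', hm'⟩ := h.exists_step hG hs hℓ hΔ hD hDX ht
      (by exact_mod_cast hm) hw'
    obtain ⟨v, hv⟩ := ih h' hm'
    exact ⟨v, w', hw', hv⟩

lemma of_iterRel (hG : IsGarsideSystem S Δ) (hs : IsSpindleType S)
    (hℓ : IsLengthFun S ℓ) (hΔ : Δ ≠ 1) (hD : eval D = Δ) (hDX : IsPosWord (atoms S) D)
    (ht : IsNF S Δ t) (m : ℕ) : ∀ {w : Word G} {r : ℤ} {L : List (Word G)} {n : ℕ} {M : ℤ},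
    IsReducing S Δ D p t w r L n M →
      ((0 ≤ r ∨ ∀ u ∈ L, IsNegBlock S Δ u) ∨ -r ≤ m) →
      ∀ {v : Word G}, iterRel (RedStep S Δ D) m w v →
      ∃ r' L' n' M', IsReducing S Δ D p t v r' L' n' M' ∧
        (0 ≤ r' ∨ ∀ u ∈ L', IsNegBlock S Δ u) := by
  induction m with
  | zero =>
    intro w r L n M h hm v hv
    obtain rfl : w = v := hv
    exact ⟨r, L, n, M, h, hm.elim id fun hm => Or.inl (by simpa using hm)⟩
  | succ m ih =>
    intro w r L n M h hm v hv
    obtain ⟨w', hw', hv⟩ := hv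
    obtain ⟨r', L', n', M', h', hm'⟩ := h.exists_step hG hs hℓ hΔ hD hDX ht
      (by exact_mod_cast hm) hw'
    exact ih h' hm' hv

end IsReducing

lemma conv_of_posBlocks (L : List (Word G)) : (∀ u ∈ L, IsPosBlock S Δ u) →
    Conv S Δ L 0 (L.map eval) := by
  induction L with
  | nil => exact fun _ => .nil
  | cons u L ih =>
    intro h
    simpa using Conv.pos (h u (by simp)) (ih fun v hv => h v (by simp [hv]))

lemma isReducing_of_isNF (hG : IsGarsideSystem S Δ) (hℓ : IsLengthFun S ℓ) {D : Word G}
    (hD : eval D = Δ) (hDX : IsPosWord (atoms S) D) {p : ℤ} {ws : List (Word G)}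
    (hws : ∀ u ∈ ws, IsPosWord (atoms S) u) (hNF : IsNF S Δ (ws.map eval)) :
    -- At the start no block is negative and every block is shorter than D, so the threshold δ
    -- works.
    IsReducing S Δ D p (ws.map eval) (wordPow D p ++ ws.flatten) p ws 0 D.length := by
  have hpos : ∀ u ∈ ws, IsPosBlock S Δ u := fun u hu =>
    ⟨hws u hu, hNF.1 _ (List.mem_map_of_mem hu)⟩
  refine ⟨rfl, conv_of_posBlocks ws hpos, by simp, by positivity, le_rfl, fun u _ hu' => ?_,
    fun u hu hu' => absurd hu' (hpos u hu).not_isNegBlock,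
    Or.inr fun u hu => (hpos u hu).not_isNegBlock⟩
  have := (length_lt_delta hG hℓ hu'.2).2.le
  rwa [hℓ.eval hu'.1, ← hD, hℓ.eval hDX] at this

end SpindleGarside

theorem mainTheorem10 {G : Type*} [Group G] (S : Set G) (Δ : G)
    (hG : SpindleGarside.IsGarsideSystem S Δ)
    (hspindle : SpindleGarside.IsSpindleType S)
    (hhom : SpindleGarside.HasHomogeneousPresentation S)
    (D : SpindleGarside.Word G)
    (hD : SpindleGarside.IsPosWord (SpindleGarside.atoms S) D)
    (hDΔ : SpindleGarside.eval D = Δ)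
    (p : ℤ) (ws : List (SpindleGarside.Word G))
    (hws : ∀ u ∈ ws, SpindleGarside.IsPosWord (SpindleGarside.atoms S) u)
    (hLNF : SpindleGarside.IsLeftNormalForm S Δ p (ws.map SpindleGarside.eval)) :
    (∃ v, SpindleGarside.IsRed S Δ D (SpindleGarside.wordPow D p ++ ws.flatten) v) ∧
    ∀ v, SpindleGarside.IsRed S Δ D (SpindleGarside.wordPow D p ++ ws.flatten) v →
      SpindleGarside.IsWord (SpindleGarside.atoms S) v ∧
      SpindleGarside.eval v =
        SpindleGarside.eval (SpindleGarside.wordPow D p ++ ws.flatten) ∧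
      ∀ w, SpindleGarside.IsWord (SpindleGarside.atoms S) w →
        SpindleGarside.eval w =
          SpindleGarside.eval (SpindleGarside.wordPow D p ++ ws.flatten) →
        v.length ≤ w.length := by
  obtain ⟨ℓ, hℓ⟩ := SpindleGarside.exists_isLengthFun hhom
  have hΔ := hLNF.delta_ne_one
  have hNF := hLNF.isNF hG hℓ
  have h := SpindleGarside.isReducing_of_isNF hG hℓ hDΔ hD (p := p) hws hNF
  have hm : (0 ≤ p ∨ ∀ u ∈ ws, SpindleGarside.IsNegBlock S Δ u) ∨ -p ≤ (p.natAbs : ℤ) := by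
    right; omega
  constructor
  · obtain ⟨v, hv⟩ := h.exists_iterRel hG hspindle hℓ hΔ hDΔ hD hNF p.natAbs hm
    exact ⟨v, p, ws, h.isMinDecomposition hG hspindle hℓ hΔ hDΔ hNF, hv⟩
  · rintro v ⟨r, L, hmin, hv⟩
    obtain ⟨rfl, rfl⟩ := h.unique hG hspindle hℓ hΔ hDΔ hNF hmin
    obtain ⟨r', L', n', M', h', hfin⟩ := h.of_iterRel hG hspindle hℓ hΔ hDΔ hD hNF _ hm hv
    have heval := (h'.eval_eq hDΔ).trans (h.eval_eq hDΔ).symm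
    refine ⟨?_, heval, fun w hw hwe =>
      h'.geodesic hG hspindle hℓ hΔ hDΔ hD hNF hfin hw (hwe.trans heval.symm)⟩
    rw [h'.eq_word]
    intro y hy
    exact (List.mem_append.1 hy).elim (SpindleGarside.isWord_wordPow hD.isWord r' y)
      (h'.conv.isWord y)
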